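/- Let $n\ge 2$, let $e_1,\dots,e_n$ be the standard basis of $\mathbb R^n$, and let $\Phi^+(D_n)=\{e_i\pm e_j : 1\le i<j\le n\}$ be the set of positive roots of type $D_n$, with simple roots $\alpha_i=e_i-e_{i+1}$ for $1\le i\le n-1$ and $\alpha_n=e_{n-1}+e_n$. Order $\Phi^+(D_n)$ by $\alpha\le\beta$ if and only if $\beta-\alpha$ is a nonnegative integer combination of simple roots. This is a finite ranked poset, with rank function $\operatorname{rk}\bigl(\sum_i a_i\alpha_i\bigr)=\sum_i a_i-1$. For a finite ranked poset $P$ with rank function $\operatorname{rk}$ (so $\operatorname{rk}$ is $0$ on minimal elements and increases by $1$ along covering relations), let $r=\max_{p\in P}\operatorname{rk}(p)$, and let $\mathcal A(P)$ be the set of antichains of $P$. For $p\in P$, the toggle $\tau_p\colon\mathcal A(P)\to\mathcal A(P)$ is given by $\tau_p(A)=A\setminus\{p\}$ if $p\in A$; $\tau_p(A)=A\cup\{p\}$ if $p\notin A$ and $A\cup\{p\}$ is an antichain; and $\tau_p(A)=A$ otherwise. Toggles at elements of equal rank commute; for $0\le i\le r$ let $\boldsymbol\tau_i$ be the composition of the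 toggles $\tau_p$ over all $p$ with $\operatorname{rk}(p)=i$. Rowvacuation is the composition (with the rightmost factor applied first) $$\mathrm{Rvac}=(\boldsymbol\tau_r)(\boldsymbol\tau_r\boldsymbol\tau_{r-1})\cdots(\boldsymbol\tau_r\boldsymbol\tau_{r-1}\cdots\boldsymbol\tau_1)(\boldsymbol\tau_r\boldsymbol\tau_{r-1}\cdots\boldsymbol\tau_0)\colon\mathcal A(P)\to\mathcal A(P).$$ Then for every antichain $A\in\mathcal A(\Phi^+(D_n))$, we have $\#A+\#\mathrm{Rvac}(A)=n$. -/

import Mathlib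

section Rowvacuation

variable {P : Type*} [PartialOrder P]

/-- The set `𝒜(P)` of antichains of a finite poset `P`. -/
abbrev Antichains (P : Type*) [PartialOrder P] : Type _ :=
  {A : Finset P // IsAntichain (· ≤ ·) (A : Set P)}

open Classical in
/-- The antichain toggle `τ_p`: remove `p` if it is present, otherwise add `p` if the result is
still an antichain, otherwise do nothing. -/
noncomputable def toggle (p : P) : Function.End (Antichains P) := fun A =>
  if p ∈ A.1 then ⟨A.1.erase p, A.2.subset (by exact_mod_cast A.1.erase_subset p)⟩
  else if h : IsAntichain (· ≤ ·) ((insert p A.1 : Finset P) : Set P) then ⟨insert p A.1, h⟩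
  else A

theorem mem_toggle (p x : P) (A : Antichains P) :
    x ∈ (toggle p A).1 ↔
      (x ≠ p ∧ x ∈ A.1) ∨ (x = p ∧ p ∉ A.1 ∧ ∀ y ∈ A.1, ¬ y ≤ p ∧ ¬ p ≤ y) := by
  classical
  unfold toggle
  by_cases hp : p ∈ A.1
  · rw [if_pos hp]
    simp only [Finset.mem_erase]
    tauto
  · rw [if_neg hp]
    have key : IsAntichain (· ≤ ·) ((insert p A.1 : Finset P) : Set P) ↔
        ∀ y ∈ A.1, ¬ y ≤ p ∧ ¬ p ≤ y := by
      rw [Finset.coe_insert, isAntichain_insert]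
      constructor
      · intro h y hy
        have hne : p ≠ y := fun e => hp (e ▸ hy)
        exact ⟨(h.2 (by exact_mod_cast hy) hne).2, (h.2 (by exact_mod_cast hy) hne).1⟩
      · intro h
        exact ⟨A.2, fun y hy _ => ⟨(h y (by exact_mod_cast hy)).2, (h y (by exact_mod_cast hy)).1⟩⟩
    by_cases h : IsAntichain (· ≤ ·) ((insert p A.1 : Finset P) : Set P)
    · rw [dif_pos h]
      have h' := key.1 h
      simp only [Finset.mem_insert]
      by_cases hx : x = p
      · simp only [hx, true_or, ne_eq, not_true_eq_false, false_and, true_and, false_or, true_iff]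
        exact ⟨hp, h'⟩
      · simp [hx]
    · rw [dif_neg h]
      have h' := fun hh => h (key.2 hh)
      by_cases hx : x = p
      · simp only [hx, ne_eq, not_true_eq_false, false_and, true_and, false_or]
        tauto
      · simp [hx]

theorem toggle_commute {p q : P} (hpq : ¬ p ≤ q) (hqp : ¬ q ≤ p) :
    Commute (toggle p) (toggle q) := by
  have hne : p ≠ q := fun e => hpq e.le
  refine funext fun A => Subtype.ext (Finset.ext fun x => ?_)
  change x ∈ (toggle p (toggle q A)).1 ↔ x ∈ (toggle q (toggle p A)).1
  have e1 : ∀ {r s : P}, r ≠ s → ¬ r ≤ s → ¬ s ≤ r →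
      ((∀ y ∈ (toggle s A).1, ¬ y ≤ r ∧ ¬ r ≤ y) ↔ (∀ y ∈ A.1, y ≠ s → ¬ y ≤ r ∧ ¬ r ≤ y)) := by
    intro r s _ hrs hsr
    constructor
    · intro h y hy hys
      exact h y ((mem_toggle s y A).2 (Or.inl ⟨hys, hy⟩))
    · intro h y hy
      rcases (mem_toggle s y A).1 hy with h1 | h1
      · exact h y h1.2 h1.1
      · rw [h1.1]; exact ⟨hsr, hrs⟩
  have e2 : ∀ {r s : P}, ¬ r ≤ s → ¬ s ≤ r →
      ((∀ y ∈ A.1, y ≠ s → ¬ y ≤ r ∧ ¬ r ≤ y) ↔ (∀ y ∈ A.1, ¬ y ≤ r ∧ ¬ r ≤ y)) := by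
    intro r s hrs hsr
    refine ⟨fun h y hy => ?_, fun h y hy _ => h y hy⟩
    by_cases hys : y = s
    · rw [hys]; exact ⟨hsr, hrs⟩
    · exact h y hy hys
  rw [mem_toggle p x (toggle q A), mem_toggle q x (toggle p A), e1 hne hpq hqp,
    e1 hne.symm hqp hpq, e2 hpq hqp, e2 hqp hpq, mem_toggle p x A, mem_toggle q x A,
    mem_toggle q p A, mem_toggle p q A]
  have hne' := hne.symm
  by_cases h1 : x = p
  · subst h1; tauto
  · tauto

/- A ranked poset is a poset with an instance of `GradeMinOrder ℕ P`: the grade of a minimal element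
is `0`, and the grade goes up by `1` along every cover. Such an instance is unique when `P` is
finite. -/
variable [Fintype P] [GradeMinOrder ℕ P]

/-- The rank `P_i = {p ∈ P : rk p = i}`. -/
def rankSet (P : Type*) [PartialOrder P] [Fintype P] [GradeMinOrder ℕ P] (i : ℕ) : Finset P :=
  Finset.univ.filter fun p => grade ℕ p = i

/-- The rank `rk(P)`: the maximum of the rank function. -/
def posetRank (P : Type*) [PartialOrder P] [Fintype P] [GradeMinOrder ℕ P] : ℕ :=
  Finset.univ.sup fun p : P => grade ℕ p

theorem rankSet_toggle_commute (i : ℕ) :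
    (rankSet P i : Set P).Pairwise (Function.onFun Commute (toggle (P := P))) := by
  intro p hp q hq hne
  have hp' : grade ℕ p = i := by simpa [rankSet] using hp
  have hq' : grade ℕ q = i := by simpa [rankSet] using hq
  refine toggle_commute (fun h => ?_) (fun h => ?_)
  · have := grade_strictMono (𝕆 := ℕ) (lt_of_le_of_ne h hne)
    omega
  · have := grade_strictMono (𝕆 := ℕ) (lt_of_le_of_ne h hne.symm)
    omega

/-- The rank toggle `𝛕_i`, the product (composition) of the commuting toggles `τ_p`, `p ∈ P_i`. -/
noncomputable def rankToggle (P : Type*) [PartialOrder P] [Fintype P] [GradeMinOrder ℕ P] (i : ℕ) :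
    Function.End (Antichains P) :=
  (rankSet P i).noncommProd toggle (rankSet_toggle_commute i)

/-- The composition `𝛕_{rk P} 𝛕_{rk P - 1} ⋯ 𝛕_k` (so `𝛕_k` is applied first). -/
noncomputable def partialRow (P : Type*) [PartialOrder P] [Fintype P] [GradeMinOrder ℕ P] (k : ℕ) :
    Function.End (Antichains P) :=
  ((List.Ico k (posetRank P + 1)).map (rankToggle P)).reverse.prod

/-- Rowvacuation,
`(𝛕_r) (𝛕_r 𝛕_{r-1}) ⋯ (𝛕_r 𝛕_{r-1} ⋯ 𝛕_1) (𝛕_r 𝛕_{r-1} ⋯ 𝛕_0)` with `r = rk P`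
(the rightmost factor is applied first). -/
noncomputable def rowvacuation (P : Type*) [PartialOrder P] [Fintype P] [GradeMinOrder ℕ P] :
    Function.End (Antichains P) :=
  ((List.range (posetRank P + 1)).map (partialRow P)).reverse.prod

end Rowvacuation

/-- The positive roots of type `D_n`: for `i < j`, the root `e_i + e_j` if `plus` is `true` and the
root `e_i - e_j` if `plus` is `false`, see `PosRootD.vec`. Indices run through `0, …, n - 1`. -/
structure PosRootD (n : ℕ) where
  i : Fin n
  j : Fin n
  lt : i < j
  plus : Bool
  deriving DecidableEq, Fintype

namespace PosRootD

variable {n : ℕ}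

/-- The root `e_i ± e_j` as a vector in `ℝⁿ`. -/
def vec (a : PosRootD n) : Fin n → ℝ :=
  if a.plus then Pi.single a.i 1 + Pi.single a.j 1 else Pi.single a.i 1 - Pi.single a.j 1

/-- The simple roots of type `D_n`, `n ≥ 2`: `e_i - e_{i+1}` for every `i` but the last one, and
the sum of the last two basis vectors for the last `i`. -/
def simple (n : ℕ) (i : Fin n) : Fin n → ℝ :=
  if h : i.1 + 1 < n then Pi.single i 1 - Pi.single ⟨i.1 + 1, h⟩ 1
  else Pi.single ⟨i.1 - 1, by omega⟩ 1 + Pi.single i 1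

/-- The root order: `a ≤ b` if `b - a` is a nonnegative integer combination of simple roots. -/
instance : LE (PosRootD n) :=
  ⟨fun a b => ∃ c : Fin n → ℕ, b.vec - a.vec = ∑ i, c i • simple n i⟩

theorem le_def {a b : PosRootD n} :
    a ≤ b ↔ ∃ c : Fin n → ℕ, b.vec - a.vec = ∑ i, c i • simple n i := Iff.rfl

/-- The height minus one. -/
def rk (a : PosRootD n) : ℕ :=
  if a.plus then (n - 1 - a.i) + (n - 1 - a.j) - 1 else a.j - a.i - 1

/-- The linear functional that takes the value one on every simple root. -/
def ht (v : Fin n → ℝ) : ℝ := v ⬝ᵥ fun k => (n : ℝ) - 1 - (k : ℕ)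

theorem ht_single (i : Fin n) : ht (Pi.single i 1) = (n : ℝ) - 1 - (i : ℕ) := by
  simp [ht]

theorem ht_add (v w : Fin n → ℝ) : ht (v + w) = ht v + ht w := by simp [ht, add_dotProduct]
theorem ht_sub (v w : Fin n → ℝ) : ht (v - w) = ht v - ht w := by simp [ht, sub_dotProduct]

theorem ht_simple (hn : 2 ≤ n) (i : Fin n) : ht (simple n i) = 1 := by
  unfold simple
  split_ifs with h
  · rw [ht_sub, ht_single, ht_single]; push_cast; ring
  · have h1 : (i : ℕ) = n - 1 := by omega
    have h2 : ((i : ℕ) : ℝ) = n - 1 := by rw [h1, Nat.cast_sub (by omega)]; simp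
    have h3 : (((i : ℕ) - 1 : ℕ) : ℝ) = n - 2 := by
      rw [h1, Nat.cast_sub (by omega), Nat.cast_sub (by omega)]; push_cast; ring
    rw [ht_add, ht_single, ht_single, h2]
    simp only [h3]
    ring

theorem two_le (a : PosRootD n) : 2 ≤ n := by
  have := a.lt
  rw [Fin.lt_def] at this
  omega

theorem ht_sum (hn : 2 ≤ n) (c : Fin n → ℕ) :
    ht (∑ i, c i • simple n i) = ((∑ i, c i : ℕ) : ℝ) := by
  have : ht (∑ i, c i • simple n i) = ∑ i, (c i : ℝ) * ht (simple n i) := by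
    simp only [ht, sum_dotProduct, smul_dotProduct]
    simp only [nsmul_eq_mul]
  rw [this]
  simp [ht_simple hn]

theorem ht_vec (a : PosRootD n) : ht a.vec = a.rk + 1 := by
  obtain ⟨i, j, hij, s⟩ := a
  obtain ⟨i, hi⟩ := i
  obtain ⟨j, hj⟩ := j
  simp only [Fin.mk_lt_mk] at hij
  cases s
  · simp only [vec, rk, ht_sub, ht_single, Bool.false_eq_true, if_false]
    rw [Nat.sub_sub, Nat.cast_sub (by omega)]; push_cast; ring
  · simp only [vec, rk, ht_add, ht_single, if_true]
    rw [Nat.cast_sub (by omega), Nat.cast_add, Nat.sub_sub, Nat.sub_sub, Nat.cast_sub (by omega),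
      Nat.cast_sub (by omega)]
    push_cast; ring

theorem vec_injective : Function.Injective (vec (n := n)) := by
  rintro ⟨i, j, hij, s⟩ ⟨k, l, hkl, t⟩ h
  have hi := congrFun h i
  have hj := congrFun h j
  have hk := congrFun h k
  have hl := congrFun h l
  cases s <;> cases t <;>
    simp only [vec, Pi.add_apply, Pi.sub_apply, Pi.single_apply, Bool.false_eq_true, if_true,
      if_false] at hi hj hk hl <;> grind

instance : PartialOrder (PosRootD n) where
  le_refl a := ⟨0, by simp⟩
  le_trans a b c := by
    rintro ⟨f, hf⟩ ⟨g, hg⟩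
    refine ⟨f + g, ?_⟩
    simp only [Pi.add_apply, add_smul, Finset.sum_add_distrib, ← hf, ← hg]
    abel
  le_antisymm a b := by
    rintro ⟨f, hf⟩ ⟨g, hg⟩
    have h1 := congrArg ht hf
    have h2 := congrArg ht hg
    rw [ht_sub, ht_sum a.two_le] at h1 h2
    have h3 : ((∑ i, f i : ℕ) : ℝ) + ((∑ i, g i : ℕ) : ℝ) = 0 := by linarith
    have h4 : ∑ i, f i = 0 := by
      have : (∑ i, f i) + (∑ i, g i) = 0 := by exact_mod_cast h3
      omega
    have h5 : ∀ i, f i = 0 := by simpa using h4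
    apply vec_injective
    have : b.vec - a.vec = 0 := by rw [hf]; simp [h5]
    exact (sub_eq_zero.1 this).symm

theorem rk_strictMono : StrictMono (rk (n := n)) := by
  intro a b hab
  obtain ⟨f, hf⟩ := le_def.1 hab.le
  have h1 := congrArg ht hf
  rw [ht_sub, ht_sum a.two_le, ht_vec, ht_vec] at h1
  have h2 : b.rk = a.rk + ∑ i, f i := by
    have : (b.rk : ℝ) = a.rk + ((∑ i, f i : ℕ) : ℝ) := by linarith
    exact_mod_cast this
  rcases Nat.eq_zero_or_pos (∑ i, f i) with h | h
  · exfalso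
    have h5 : ∀ i, f i = 0 := by simpa using h
    have : b.vec - a.vec = 0 := by rw [hf]; simp [h5]
    exact hab.ne (vec_injective (sub_eq_zero.1 this).symm)
  · omega

theorem vec_plus {i j : Fin n} (h : i < j) :
    vec ⟨i, j, h, true⟩ = Pi.single i 1 + Pi.single j 1 := rfl

theorem vec_minus {i j : Fin n} (h : i < j) :
    vec ⟨i, j, h, false⟩ = Pi.single i 1 - Pi.single j 1 := rfl

theorem simple_of_lt {i k : Fin n} (h : k.1 = i.1 + 1) :
    simple n i = Pi.single i 1 - Pi.single k 1 := by
  obtain ⟨k, hk⟩ := k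
  simp only at h
  subst h
  rw [simple, dif_pos hk]

theorem simple_last {i k : Fin n} (h : k.1 + 1 = i.1) (hi : i.1 + 1 = n) :
    simple n i = Pi.single k 1 + Pi.single i 1 := by
  have : (⟨i.1 - 1, by omega⟩ : Fin n) = k := Fin.ext (by simp only; omega)
  rw [simple, dif_neg (by omega), this]

theorem simple_cases (hn : 2 ≤ n) (i : Fin n) :
    (∃ k : Fin n, k.1 = i.1 + 1 ∧ simple n i = Pi.single i 1 - Pi.single k 1) ∨
    (∃ k : Fin n, k.1 + 1 = i.1 ∧ i.1 + 1 = n ∧ simple n i = Pi.single k 1 + Pi.single i 1) := by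
  by_cases h : i.1 + 1 < n
  · exact Or.inl ⟨⟨i.1 + 1, h⟩, rfl, simple_of_lt rfl⟩
  · have h1 : (⟨i.1 - 1, by omega⟩ : Fin n).1 + 1 = i.1 := by simp only; omega
    exact Or.inr ⟨⟨i.1 - 1, by omega⟩, h1, by omega, simple_last h1 (by omega)⟩

theorem sub_simple {b : PosRootD n} {i : Fin n} (h : 0 < b.vec ⬝ᵥ simple n i) :
    b.vec = simple n i ∨ ∃ b' : PosRootD n, b'.vec = b.vec - simple n i := by
  have hn := b.two_le
  obtain ⟨p, q, hpq, s⟩ := b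
  rcases simple_cases hn i with ⟨k, hk, e⟩ | ⟨k, hk, hi, e⟩ <;> rw [e] at h ⊢ <;> cases s
  · rw [vec_minus] at h ⊢
    simp only [dotProduct_sub, dotProduct_single_one, Pi.sub_apply, Pi.single_apply] at h
    by_cases hp : i = p
    · subst hp
      by_cases hq : k = q
      · subst hq; exact Or.inl rfl
      · refine Or.inr ⟨⟨k, q, by grind, false⟩, ?_⟩
        rw [vec_minus]; abel
    · have hq : k = q := by grind
      subst hq
      refine Or.inr ⟨⟨p, i, by grind, false⟩, ?_⟩
      rw [vec_minus]; abel
  · rw [vec_plus] at h ⊢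
    simp only [dotProduct_sub, dotProduct_single_one, Pi.add_apply, Pi.single_apply] at h
    by_cases hp : i = p
    · subst hp
      refine Or.inr ⟨⟨k, q, by grind, true⟩, ?_⟩
      rw [vec_plus]; abel
    · have hq : i = q := by grind
      subst hq
      refine Or.inr ⟨⟨p, k, by grind, true⟩, ?_⟩
      rw [vec_plus]; abel
  · rw [vec_minus] at h ⊢
    simp only [dotProduct_add, dotProduct_single_one, Pi.sub_apply, Pi.single_apply] at h
    grind
  · rw [vec_plus] at h ⊢
    simp only [dotProduct_add, dotProduct_single_one, Pi.add_apply, Pi.single_apply] at h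
    by_cases hp : k = p
    · subst hp
      have hq : i = q := by grind
      subst hq; exact Or.inl rfl
    · by_cases hq : i = q
      · subst hq
        refine Or.inr ⟨⟨p, k, by grind, false⟩, ?_⟩
        rw [vec_minus]; abel
      · have hq' : k = q := by grind
        subst hq'
        refine Or.inr ⟨⟨p, i, by grind, false⟩, ?_⟩
        rw [vec_minus]; abel

theorem add_simple {a : PosRootD n} {i : Fin n} (h : a.vec ⬝ᵥ simple n i < 0) :
    ∃ a' : PosRootD n, a'.vec = a.vec + simple n i := by
  have hn := a.two_le
  obtain ⟨p, q, hpq, s⟩ := a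
  rcases simple_cases hn i with ⟨k, hk, e⟩ | ⟨k, hk, hi, e⟩ <;> rw [e] at h ⊢ <;> cases s
  · rw [vec_minus] at h ⊢
    simp only [dotProduct_sub, dotProduct_single_one, Pi.sub_apply, Pi.single_apply] at h
    by_cases hp : k = p
    · subst hp
      refine ⟨⟨i, q, by grind, false⟩, ?_⟩
      rw [vec_minus]; abel
    · have hq : i = q := by grind
      subst hq
      refine ⟨⟨p, k, by grind, false⟩, ?_⟩
      rw [vec_minus]; abel
  · rw [vec_plus] at h ⊢
    simp only [dotProduct_sub, dotProduct_single_one, Pi.add_apply, Pi.single_apply] at h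
    by_cases hp : k = p
    · subst hp
      refine ⟨⟨i, q, by grind, true⟩, ?_⟩
      rw [vec_plus]; abel
    · have hq : k = q := by grind
      subst hq
      refine ⟨⟨p, i, by grind, true⟩, ?_⟩
      rw [vec_plus]; abel
  · rw [vec_minus] at h ⊢
    simp only [dotProduct_add, dotProduct_single_one, Pi.sub_apply, Pi.single_apply] at h
    by_cases hq : i = q
    · subst hq
      refine ⟨⟨p, k, by grind, true⟩, ?_⟩
      rw [vec_plus]; abel
    · have hq' : k = q := by grind
      subst hq'
      refine ⟨⟨p, i, by grind, true⟩, ?_⟩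
      rw [vec_plus]; abel
  · rw [vec_plus] at h ⊢
    simp only [dotProduct_add, dotProduct_single_one, Pi.add_apply, Pi.single_apply] at h
    grind

theorem rk_eq_of_sub {a b : PosRootD n} {i : Fin n} (h : b.vec - a.vec = simple n i) :
    b.rk = a.rk + 1 := by
  have h1 := congrArg ht h
  rw [ht_sub, ht_simple a.two_le, ht_vec, ht_vec] at h1
  have : (b.rk : ℝ) = a.rk + 1 := by linarith
  exact_mod_cast this

theorem le_of_sub {a b : PosRootD n} {i : Fin n} (h : b.vec - a.vec = simple n i) : a ≤ b :=
  ⟨Pi.single i 1, by simp [h, Pi.single_apply]⟩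

theorem rk_covBy {a b : PosRootD n} (hab : a ⋖ b) : b.rk = a.rk + 1 := by
  obtain ⟨f, hf⟩ := le_def.1 hab.le
  have hne : b.vec - a.vec ≠ 0 := fun h => hab.lt.ne (vec_injective (sub_eq_zero.1 h).symm)
  have hpos : 0 < (b.vec - a.vec) ⬝ᵥ (b.vec - a.vec) := by
    have h0 : 0 ≤ (b.vec - a.vec) ⬝ᵥ (b.vec - a.vec) :=
      Finset.sum_nonneg fun i _ => mul_self_nonneg _
    exact lt_of_le_of_ne h0 fun h => hne (dotProduct_self_eq_zero.1 h.symm)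
  have hex : ∃ i, 0 < (f i : ℝ) * ((b.vec - a.vec) ⬝ᵥ simple n i) := by
    by_contra! hcon
    have : (b.vec - a.vec) ⬝ᵥ (b.vec - a.vec) =
        ∑ i, (f i : ℝ) * ((b.vec - a.vec) ⬝ᵥ simple n i) := by
      conv_lhs => rw [hf]
      conv_rhs => rw [hf]
      rw [dotProduct_sum]
      simp only [dotProduct_smul]
      simp only [nsmul_eq_mul]
    have h2 := Finset.sum_nonpos fun i (_ : i ∈ Finset.univ) => hcon i
    linarith
  obtain ⟨i, hi⟩ := hex
  have hfi : f i ≠ 0 := by intro h; simp [h] at hi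
  have hdi : 0 < (b.vec - a.vec) ⬝ᵥ simple n i :=
    pos_of_mul_pos_right hi (by positivity)
  let g : Fin n → ℕ := Function.update f i (f i - 1)
  have hfg : ∀ k, f k = g k + (Pi.single i 1 : Fin n → ℕ) k := by
    intro k
    by_cases hk : k = i
    · subst hk; simp [g]; omega
    · simp [g, hk]
  have hg : ∑ k, g k • simple n k = b.vec - a.vec - simple n i := by
    have h1 : ∑ k, f k • simple n k = ∑ k, g k • simple n k + simple n i := by
      simp_rw [hfg, add_smul, Finset.sum_add_distrib]
      simp [Pi.single_apply]
    rw [hf, h1]; abel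
  by_cases hb : 0 < b.vec ⬝ᵥ simple n i
  · rcases sub_simple hb with h | ⟨b', hb'⟩
    · exfalso
      have h1 := congrArg ht hg
      rw [ht_sum a.two_le, ht_sub, ht_sub, h, ht_vec] at h1
      have h2 : (0 : ℝ) ≤ ((∑ k, g k : ℕ) : ℝ) := Nat.cast_nonneg _
      have h3 : (0 : ℝ) ≤ a.rk := Nat.cast_nonneg _
      linarith
    · have h1 : b.vec - b'.vec = simple n i := by rw [hb']; abel
      have h2 : a ≤ b' := ⟨g, by rw [hg, hb']; abel⟩
      have h3 := rk_eq_of_sub h1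
      have h4 : b' < b := lt_of_le_of_ne (le_of_sub h1) (fun e => by rw [e] at h3; omega)
      have h5 : a = b' := by
        by_contra hne'
        exact hab.2 (lt_of_le_of_ne h2 hne') h4
      rw [h5]; exact h3
  · have ha : a.vec ⬝ᵥ simple n i < 0 := by
      rw [sub_dotProduct] at hdi
      linarith
    obtain ⟨a', ha'⟩ := add_simple ha
    have h1 : a'.vec - a.vec = simple n i := by rw [ha']; abel
    have h2 : a' ≤ b := ⟨g, by rw [hg, ha']; abel⟩
    have h3 := rk_eq_of_sub h1
    have h4 : a < a' := lt_of_le_of_ne (le_of_sub h1) (fun e => by rw [← e] at h3; omega)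
    have h5 : a' = b := by
      by_contra hne'
      exact hab.2 h4 (lt_of_le_of_ne h2 hne')
    rw [← h5]; exact h3

theorem rk_of_isMin {a : PosRootD n} (ha : IsMin a) : a.rk = 0 := by
  suffices h : a.rk = 0 ∨ ∃ (i : Fin n) (b : PosRootD n), a.vec - b.vec = simple n i by
    rcases h with h | ⟨i, b, h⟩
    · exact h
    · have h1 := ha (le_of_sub h)
      have h2 := le_antisymm h1 (le_of_sub h)
      have h3 := rk_eq_of_sub h
      rw [h2] at h3
      omega
  clear ha
  obtain ⟨p, q, hpq, s⟩ := a
  have hpq' : p.1 < q.1 := hpq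
  by_cases h1 : p.1 + 1 < q.1
  · have e : simple n p = Pi.single p 1 - Pi.single ⟨p.1 + 1, by omega⟩ 1 := simple_of_lt rfl
    refine Or.inr ⟨p, ⟨⟨p.1 + 1, by omega⟩, q, h1, s⟩, ?_⟩
    cases s
    · rw [e, vec_minus, vec_minus]; abel
    · rw [e, vec_plus, vec_plus]; abel
  · cases s
    · left
      simp only [rk, Bool.false_eq_true, if_false]
      omega
    · by_cases h2 : q.1 + 1 < n
      · have e : simple n q = Pi.single q 1 - Pi.single ⟨q.1 + 1, h2⟩ 1 := simple_of_lt rfl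
        refine Or.inr ⟨q, ⟨p, ⟨q.1 + 1, h2⟩, Fin.lt_def.2 (by simp only; omega), true⟩, ?_⟩
        rw [e, vec_plus, vec_plus]; abel
      · left
        simp only [rk, if_true]
        omega

/-- The root poset of type `D_n` is ranked by height minus one. -/
instance : GradeMinOrder ℕ (PosRootD n) where
  grade := rk
  grade_strictMono := rk_strictMono
  covBy_grade a b h := by
    rw [Nat.covBy_iff_add_one_eq]
    exact (rk_covBy h).symm
  isMin_grade a h := by
    rw [rk_of_isMin h]
    exact fun _ _ => Nat.zero_le _

end PosRootD

/-! Write `I(A)` for the lower closure of an antichain `A`, `Row` for `partialRow _ 0` and `R` for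
rowvacuation; coordinates are numbered from 0, and `α_a = e_a - e_{a+1}`.

On any finite ranked poset, antichain toggles translate into order toggles on upper sets, where
toggles at ranks differing by at least two commute. A computation with involutions
(`involution_words`) then gives `R ∘ R = id` and `Row ∘ R ∘ Row = R`. Moreover a minimal element
lies in `R(A)` exactly when it is not in `I(A)`, and `R` respects rank-preserving automorphisms.

In type `D_n`, a row or column of roots is met by `A` or not. `Row` shifts columns up by one index
and rows down by one, as long as certain simple roots lie in `I(A)`; otherwise the rule for minimal
elements decides directly. With `Row ∘ R ∘ Row = R`, induction on `a < n - 2` shows that `A` meets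
row `a` exactly when `R(A)` misses column `a`. The same shift across the fork of the diagram shows
that exactly one of `A`, `R(A)` contains roots `e_i ± e_{n-1}` of both signs, except in the
`IsolatedLast` case, which `R` preserves.

For the count, let `ℓ` be the number of roots of `A` with `j = n - 1` and `δ = twinCard +
selfDualCard`. An antichain meets each column in at most one root, and each row in at most one root
apart from a pair `e_a ± e_{n-1}`. Adding the row-column exchange for `A` and for `R(A)` gives `2(#A
+ #R(A)) = 2(n - 2) + ℓ(A) + ℓ(R(A)) + δ(A) + δ(R(A))`. The last four terms have an even sum, and
bounds on `ℓ` and `δ` place it between 3 and 5, so it is 4. -/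

section OrderToggles

/-! ### Antichain toggles and order toggles on upper sets -/

variable {P : Type*} [PartialOrder P]

theorem grade_eq_of_covBy [GradeMinOrder ℕ P] {x y : P} (h : x ⋖ y) : grade ℕ y = grade ℕ x + 1 :=
  (Nat.covBy_iff_add_one_eq.1 (h.grade ℕ)).symm

theorem exists_minimal_le_mem [Fintype P] (U : UpperSet P) {x : P} (hx : x ∈ U) :
    ∃ y ≤ x, Minimal (· ∈ U) y :=
  (Set.toFinite (U : Set P)).exists_le_minimal hx

theorem exists_maximal_ge_notMem [Fintype P] (U : UpperSet P) {x : P} (hx : x ∉ U) :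
    ∃ y, x ≤ y ∧ Maximal (· ∉ U) y :=
  (Set.toFinite {x | x ∉ U}).exists_le_maximal hx

/-- Elements of `s` are pairwise incomparable, so toggling one never affects whether another can be
added; each toggle may be evaluated on the original `A`. -/
theorem mem_noncommProd_toggle (s : Finset P)
    (comm : (s : Set P).Pairwise (Function.onFun Commute (toggle (P := P))))
    (hs : IsAntichain (· ≤ ·) (s : Set P)) (A : Antichains P) (x : P) :
    x ∈ (s.noncommProd toggle comm A).1 ↔
      (x ∉ s ∧ x ∈ A.1) ∨ (x ∈ s ∧ x ∉ A.1 ∧ ∀ y ∈ A.1, ¬ y ≤ x ∧ ¬ x ≤ y) := by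
  classical
  induction s using Finset.induction_on generalizing x with
  | empty => simp only [Finset.noncommProd_empty, Finset.notMem_empty, not_false_eq_true, true_and,
      false_and, or_false]; rfl
  | insert p s hp ih =>
    rw [Finset.noncommProd_insert_of_notMem _ _ _ _ hp]
    have hs' : IsAntichain (· ≤ ·) (s : Set P) := hs.subset (by simp)
    have comm' : (s : Set P).Pairwise (Function.onFun Commute (toggle (P := P))) :=
      comm.mono (by simp)
    have ih' := ih comm' hs'
    have hps : ∀ y ∈ s, ¬ y ≤ p ∧ ¬ p ≤ y := fun y hy =>
      have hne : y ≠ p := fun e => hp (e ▸ hy)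
      ⟨hs (by simp [hy]) (by simp) hne, hs (by simp) (by simp [hy]) hne.symm⟩
    change x ∈ (toggle p (s.noncommProd toggle comm' A)).1 ↔ _
    rw [mem_toggle, ih', ih']
    have hcomp : (∀ y ∈ (s.noncommProd toggle comm' A).1, ¬ y ≤ p ∧ ¬ p ≤ y) ↔
        ∀ y ∈ A.1, ¬ y ≤ p ∧ ¬ p ≤ y := by
      constructor
      · intro h y hy
        by_cases hys : y ∈ s
        · exact hps y hys
        · exact h y ((ih' y).2 (Or.inl ⟨hys, hy⟩))
      · intro h y hy
        rcases (ih' y).1 hy with h1 | h1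
        · exact h y h1.2
        · exact hps y h1.1
    rw [hcomp]
    by_cases hx : x = p
    · subst hx
      simp only [Finset.mem_insert]
      tauto
    · simp only [Finset.mem_insert]
      tauto

variable [Fintype P] [GradeMinOrder ℕ P]

theorem grade_le_posetRank (x : P) : grade ℕ x ≤ posetRank P :=
  Finset.le_sup (f := fun p : P => grade ℕ p) (Finset.mem_univ x)

/-- Toggle all elements of grade `k` of an upper set whose toggling gives an upper set. -/
def orderToggle (k : ℕ) : Function.End (UpperSet P) := fun U =>
  -- At grade `k`, a lower cover in `U` blocks the removal of `x`, and a missing `x` enters when all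
  -- its upper covers are in `U`.
  { carrier := {x | (grade ℕ x ≠ k ∧ x ∈ U) ∨ (grade ℕ x = k ∧
    ((∃ y, y ⋖ x ∧ y ∈ U) ∨ (x ∉ U ∧ ∀ y, x ⋖ y → y ∈ U)))}
    upper' := by
      intro x z hxz hx
      rcases eq_or_lt_of_le hxz with rfl | hlt
      · exact hx
      simp only [Set.mem_ofPred_eq] at hx ⊢
      have hg : grade ℕ x < grade ℕ z := grade_strictMono hlt
      rcases hx with ⟨_, hxU⟩ | ⟨hk, hx⟩
      · by_cases hz : grade ℕ z = k
        · obtain ⟨y, hxy, hyz⟩ := exists_le_covBy_of_lt hlt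
          exact Or.inr ⟨hz, Or.inl ⟨y, hyz, U.upper hxy hxU⟩⟩
        · exact Or.inl ⟨hz, U.upper hxz hxU⟩
      · refine Or.inl ⟨by omega, ?_⟩
        rcases hx with ⟨y, hy, hyU⟩ | ⟨_, h⟩
        · exact U.upper (hy.le.trans hxz) hyU
        · obtain ⟨y, hy, hyz⟩ := exists_covBy_le_of_lt hlt
          exact U.upper hyz (h y hy) }

theorem mem_orderToggle_of_ne {k : ℕ} {x : P} (h : grade ℕ x ≠ k) (U : UpperSet P) :
    x ∈ orderToggle k U ↔ x ∈ U := by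
  change (_ ∨ _) ↔ _
  tauto

theorem mem_orderToggle_of_eq {k : ℕ} {x : P} (h : grade ℕ x = k) (U : UpperSet P) :
    x ∈ orderToggle k U ↔ (∃ y, y ⋖ x ∧ y ∈ U) ∨ (x ∉ U ∧ ∀ y, x ⋖ y → y ∈ U) := by
  change (_ ∨ _) ↔ _
  simp only [h, ne_eq, not_true_eq_false, false_and, true_and, false_or]

theorem mem_orderToggle_of_covBy_left {k : ℕ} {x y : P} (hk : grade ℕ x = k) (h : y ⋖ x)
    (U : UpperSet P) : y ∈ orderToggle k U ↔ y ∈ U :=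
  mem_orderToggle_of_ne (by have := grade_eq_of_covBy h; omega) U

theorem mem_orderToggle_of_covBy_right {k : ℕ} {x y : P} (hk : grade ℕ x = k) (h : x ⋖ y)
    (U : UpperSet P) : y ∈ orderToggle k U ↔ y ∈ U :=
  mem_orderToggle_of_ne (by have := grade_eq_of_covBy h; omega) U

theorem orderToggle_mul_self (k : ℕ) : orderToggle (P := P) k * orderToggle k = 1 := by
  refine funext fun U => SetLike.ext fun x => ?_
  change x ∈ orderToggle k (orderToggle k U) ↔ x ∈ U
  by_cases hk : grade ℕ x = k
  · rw [mem_orderToggle_of_eq hk]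
    have h1 : (∃ y, y ⋖ x ∧ y ∈ orderToggle k U) ↔ ∃ y, y ⋖ x ∧ y ∈ U :=
      exists_congr fun y => and_congr_right fun h => mem_orderToggle_of_covBy_left hk h U
    have h2 : (∀ y, x ⋖ y → y ∈ orderToggle k U) ↔ ∀ y, x ⋖ y → y ∈ U :=
      forall_congr' fun y => imp_congr_right fun h => mem_orderToggle_of_covBy_right hk h U
    rw [h1, h2, mem_orderToggle_of_eq hk]
    have h3 : (∃ y, y ⋖ x ∧ y ∈ U) → x ∈ U := fun ⟨y, hy, hyU⟩ => U.upper hy.le hyU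
    have h4 : x ∈ U → ∀ y, x ⋖ y → y ∈ U := fun hx y hy => U.upper hy.le hx
    generalize (∃ y, y ⋖ x ∧ y ∈ U) = p at *
    generalize (∀ y, x ⋖ y → y ∈ U) = q at *
    tauto
  · rw [mem_orderToggle_of_ne hk, mem_orderToggle_of_ne hk]

theorem orderToggle_commute {i j : ℕ} (hij : i + 2 ≤ j) :
    Commute (orderToggle (P := P) i) (orderToggle j) := by
  refine funext fun U => SetLike.ext fun x => ?_
  change x ∈ orderToggle i (orderToggle j U) ↔ x ∈ orderToggle j (orderToggle i U)
  have key : ∀ {k l : ℕ}, (k + 2 ≤ l ∨ l + 2 ≤ k) → grade ℕ x = k →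
      (x ∈ orderToggle k (orderToggle l U) ↔ x ∈ orderToggle l (orderToggle k U)) := by
    intro k l hkl hk
    have h1 : (∃ y, y ⋖ x ∧ y ∈ orderToggle l U) ↔ ∃ y, y ⋖ x ∧ y ∈ U :=
      exists_congr fun y => and_congr_right fun h =>
        mem_orderToggle_of_ne (by have := grade_eq_of_covBy h; omega) U
    have h2 : (∀ y, x ⋖ y → y ∈ orderToggle l U) ↔ ∀ y, x ⋖ y → y ∈ U :=
      forall_congr' fun y => imp_congr_right fun h =>
        mem_orderToggle_of_ne (by have := grade_eq_of_covBy h; omega) U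
    rw [mem_orderToggle_of_ne (k := l) (by omega), mem_orderToggle_of_eq hk, h1, h2,
      mem_orderToggle_of_ne (k := l) (by omega), mem_orderToggle_of_eq hk]
  by_cases hi : grade ℕ x = i
  · exact key (Or.inl hij) hi
  by_cases hj : grade ℕ x = j
  · exact (key (Or.inr hij) hj).symm
  · rw [mem_orderToggle_of_ne hi, mem_orderToggle_of_ne hj, mem_orderToggle_of_ne hj,
      mem_orderToggle_of_ne hi]

open Classical in
/-- The antichain made of the minimal elements of `U` of grade less than `k` and the maximal
elements of the complement of `U` of grade at least `k`. -/
noncomputable def levelAntichain (k : ℕ) (U : UpperSet P) : Antichains P :=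
  ⟨Finset.univ.filter fun x => (grade ℕ x < k ∧ Minimal (· ∈ U) x) ∨
      (k ≤ grade ℕ x ∧ Maximal (· ∉ U) x), by
    intro x hx y hy hne hxy
    have hlt : grade ℕ x < grade ℕ y := grade_strictMono (lt_of_le_of_ne hxy hne)
    simp only [Finset.coe_filter, Finset.mem_univ, true_and, Set.mem_ofPred_eq] at hx hy
    rcases hx with ⟨h1, h2⟩ | ⟨h1, h2⟩ <;> rcases hy with ⟨h3, h4⟩ | ⟨h3, h4⟩
    · exact hne (h4.eq_of_le h2.prop hxy)
    · exact h4.prop (U.upper hxy h2.prop)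
    · omega
    · exact hne (h2.eq_of_le h4.prop hxy)⟩

theorem mem_levelAntichain {k : ℕ} {U : UpperSet P} {x : P} :
    x ∈ (levelAntichain k U).1 ↔ (grade ℕ x < k ∧ Minimal (· ∈ U) x) ∨
      (k ≤ grade ℕ x ∧ Maximal (· ∉ U) x) := by
  simp [levelAntichain]

/-- Minimality and maximality depend only on covers, which lie at neighbouring grades. At grade `k`
the toggle turns the maximal non-members of `U` into the minimal members of the new set, and
conversely. -/
theorem levelAntichain_succ_orderToggle (k : ℕ) (U : UpperSet P) :
    levelAntichain (k + 1) (orderToggle k U) = levelAntichain k U := by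
  have hmin : ∀ {x : P} (V : UpperSet P), Minimal (· ∈ V) x ↔ x ∈ V ∧ ∀ y, y ⋖ x → y ∉ V := by
    intro x V
    refine ⟨fun h => ⟨h.prop, fun y hy hyV => hy.lt.ne (h.eq_of_le hyV hy.le)⟩, fun h =>
      ⟨h.1, fun y hy hyx => ?_⟩⟩
    rcases eq_or_lt_of_le hyx with rfl | hlt
    · exact le_rfl
    · obtain ⟨z, hyz, hz⟩ := exists_le_covBy_of_lt hlt
      exact absurd (V.upper hyz hy) (h.2 z hz)
  have hmax : ∀ {x : P} (V : UpperSet P), Maximal (· ∉ V) x ↔ x ∉ V ∧ ∀ y, x ⋖ y → y ∈ V := by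
    intro x V
    refine ⟨fun h => ⟨h.prop, fun y hy => by_contra fun hyV => hy.lt.ne (h.eq_of_le hyV hy.le)⟩,
      fun h => ⟨h.1, fun y hy hyx => ?_⟩⟩
    rcases eq_or_lt_of_le hyx with rfl | hlt
    · exact le_rfl
    · obtain ⟨z, hz, hyz⟩ := exists_covBy_le_of_lt hlt
      exact absurd (V.upper hyz (h.2 z hz)) hy
  refine Subtype.ext (Finset.ext fun x => ?_)
  rw [mem_levelAntichain, mem_levelAntichain, hmin, hmin, hmax, hmax]
  rcases lt_trichotomy (grade ℕ x) k with h | h | h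
  · have h2 : (∀ y, y ⋖ x → y ∉ orderToggle k U) ↔ ∀ y, y ⋖ x → y ∉ U :=
      forall_congr' fun y => imp_congr_right fun h =>
        not_congr (mem_orderToggle_of_ne (by have := grade_eq_of_covBy h; omega) U)
    rw [h2, mem_orderToggle_of_ne h.ne]
    have h3 : grade ℕ x < k + 1 := by omega
    have h4 : ¬ k ≤ grade ℕ x := by omega
    have h5 : ¬ k + 1 ≤ grade ℕ x := by omega
    tauto
  · have h2 : (∀ y, y ⋖ x → y ∉ orderToggle k U) ↔ ∀ y, y ⋖ x → y ∉ U :=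
      forall_congr' fun y => imp_congr_right fun hy =>
        not_congr (mem_orderToggle_of_covBy_left h hy U)
    rw [h2, mem_orderToggle_of_eq h]
    have h3 : grade ℕ x < k + 1 := by omega
    have h4 : k ≤ grade ℕ x := by omega
    have h5 : ¬ k + 1 ≤ grade ℕ x := by omega
    have h6 : ¬ grade ℕ x < k := by omega
    have h7 : (∃ y, y ⋖ x ∧ y ∈ U) → x ∈ U := fun ⟨y, hy, hyU⟩ => U.upper hy.le hyU
    have h8 : (∀ y, y ⋖ x → y ∉ U) ↔ ¬ ∃ y, y ⋖ x ∧ y ∈ U := by push Not; rfl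
    tauto
  · have h2 : (∀ y, x ⋖ y → y ∈ orderToggle k U) ↔ ∀ y, x ⋖ y → y ∈ U :=
      forall_congr' fun y => imp_congr_right fun h =>
        mem_orderToggle_of_ne (by have := grade_eq_of_covBy h; omega) U
    rw [h2, mem_orderToggle_of_ne h.ne']
    have h3 : ¬ grade ℕ x < k + 1 := by omega
    have h4 : k ≤ grade ℕ x := by omega
    have h5 : k + 1 ≤ grade ℕ x := by omega
    have h6 : ¬ grade ℕ x < k := by omega
    tauto

theorem mem_rankToggle (k : ℕ) (A : Antichains P) (x : P) :
    x ∈ (rankToggle P k A).1 ↔ (grade ℕ x ≠ k ∧ x ∈ A.1) ∨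
      (grade ℕ x = k ∧ x ∉ A.1 ∧ ∀ y ∈ A.1, ¬ y ≤ x ∧ ¬ x ≤ y) := by
  unfold rankToggle
  rw [mem_noncommProd_toggle]
  · simp [rankSet]
  · intro x hx y hy hne hxy
    have := grade_strictMono (𝕆 := ℕ) (lt_of_le_of_ne hxy hne)
    simp only [rankSet, Finset.coe_filter, Finset.mem_univ, true_and, Set.mem_ofPred_eq] at hx hy
    omega

/-- At grade `k`, an element is incomparable to the whole level antichain exactly when neither a
maximal non-member lies above it nor a minimal member below it, which makes it a minimal member of
`U`. Thus one rank toggle moves the switching level up by one, with `U` fixed. -/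
theorem rankToggle_levelAntichain (k : ℕ) (U : UpperSet P) :
    rankToggle P k (levelAntichain k U) = levelAntichain (k + 1) U := by
  refine Subtype.ext (Finset.ext fun x => ?_)
  rw [mem_rankToggle]
  by_cases hk : grade ℕ x = k
  · rw [mem_levelAntichain (k := k + 1)]
    constructor
    · rintro (h | ⟨-, hx, h⟩)
      · exact absurd hk h.1
      · refine Or.inl ⟨by omega, ?_, fun y hyU hyx => ?_⟩
        · by_contra hxU
          obtain ⟨y, hxy, hy⟩ := exists_maximal_ge_notMem U hxU
          have hg : grade ℕ x ≤ grade ℕ y := grade_mono hxy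
          exact (h y (mem_levelAntichain.2 (Or.inr ⟨by omega, hy⟩))).2 hxy
        · rcases eq_or_lt_of_le hyx with rfl | hlt
          · exact le_rfl
          · obtain ⟨z, hzy, hz⟩ := exists_minimal_le_mem U hyU
            have hg : grade ℕ z < grade ℕ x := grade_strictMono (lt_of_le_of_lt hzy hlt)
            exact absurd (hzy.trans hyx)
              (h z (mem_levelAntichain.2 (Or.inl ⟨by omega, hz⟩))).1
    · rintro (⟨-, hx⟩ | ⟨h, -⟩)
      · refine Or.inr ⟨hk, ?_, fun y hy => ?_⟩
        · rw [mem_levelAntichain]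
          rintro (h | h)
          · omega
          · exact h.2.prop hx.prop
        · rcases mem_levelAntichain.1 hy with h | h
          · refine ⟨fun hyx => ?_, fun hxy => ?_⟩
            · have := hx.eq_of_le h.2.prop hyx
              subst this; omega
            · have hg : grade ℕ x ≤ grade ℕ y := grade_mono hxy
              omega
          · refine ⟨fun hyx => ?_, fun hxy => h.2.prop (U.upper hxy hx.prop)⟩
            have hg : grade ℕ y ≤ grade ℕ x := grade_mono hyx
            rcases eq_or_lt_of_le hyx with rfl | hlt
            · exact h.2.prop hx.prop
            · have := grade_strictMono (𝕆 := ℕ) hlt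
              omega
      · omega
  · rw [mem_levelAntichain, mem_levelAntichain]
    have h1 : grade ℕ x < k + 1 ↔ grade ℕ x < k := by omega
    have h2 : k + 1 ≤ grade ℕ x ↔ k ≤ grade ℕ x := by omega
    rw [h1, h2]
    tauto

end OrderToggles

/-! ### Words in involutions -/

section Words

variable {M : Type*} [Monoid M]

/-- In a monoid, let `t i` be involutions that commute when their indices differ by at least two.
With `w k = t k ⋯ t r` and `v k = w r ⋯ w k`, the element `v k` is an involution and
`w k * v k = v (k + 1)`. -/
theorem involution_words (t w v : ℕ → M) (r : ℕ) (ht : ∀ i, t i * t i = 1)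
    (hcomm : ∀ i j, i + 2 ≤ j → Commute (t i) (t j))
    (hw : ∀ k, k ≤ r → w k = t k * w (k + 1)) (hw' : ∀ k, r < k → w k = 1)
    (hv : ∀ k, k ≤ r → v k = v (k + 1) * w k) (hv' : ∀ k, r < k → v k = 1) (k : ℕ) :
    v k * v k = 1 ∧ w k * v k = v (k + 1) := by
  have commw : ∀ i j, i + 2 ≤ j → Commute (t i) (w j) := by
    intro i j hij
    by_cases hj : j ≤ r + 1
    · induction hj using Nat.decreasingInduction with
      | self => rw [hw' _ (Nat.lt_succ_self r)]; exact Commute.one_right _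
      | of_succ j hj ih =>
        rw [hw j (by omega)]
        exact (hcomm i j hij).mul_right (ih (by omega))
    · rw [hw' _ (by omega)]; exact Commute.one_right _
  have commv : ∀ i j, i + 2 ≤ j → Commute (t i) (v j) := by
    intro i j hij
    by_cases hj : j ≤ r + 1
    · induction hj using Nat.decreasingInduction with
      | self => rw [hv' _ (Nat.lt_succ_self r)]; exact Commute.one_right _
      | of_succ j hj ih =>
        rw [hv j (by omega)]
        exact (ih (by omega)).mul_right (commw i j hij)
    · rw [hv' _ (by omega)]; exact Commute.one_right _
  by_cases hk : k ≤ r + 1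
  · induction hk using Nat.decreasingInduction with
    | self => simp [hw' (r + 1) (by omega), hv' (r + 1) (by omega), hv' (r + 1 + 1) (by omega)]
    | of_succ k hk ih =>
      obtain ⟨ih1, ih2⟩ := ih
      have hvk := hv k (by omega)
      have hwk := hw k (by omega)
      have hwv : w k * v k = v (k + 1) := by
        -- The induction hypothesis replaces the bracket by `v (k + 2)`, which commutes with `t k`;
        -- the two copies of `t k` cancel.
        calc w k * v k = t k * (w (k + 1) * v (k + 1)) * (t k * w (k + 1)) := by
              rw [hvk, hwk]; simp only [mul_assoc]
          _ = t k * t k * v (k + 1 + 1) * w (k + 1) := by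
              rw [ih2, mul_assoc, ← mul_assoc (v (k + 1 + 1)), ← (commv k (k + 1 + 1) le_rfl).eq]
              simp only [mul_assoc]
          _ = v (k + 1) := by
              rw [ht, one_mul]
              by_cases hk' : k + 1 ≤ r
              · rw [← hv _ hk']
              · rw [hv' (k + 1 + 1) (by omega), hv' (k + 1) (by omega), hw' (k + 1) (by omega),
                  one_mul]
      refine ⟨?_, hwv⟩
      -- `v k * v k = v (k + 1) * (w k * v k) = v (k + 1) * v (k + 1)`.
      conv_lhs => rw [hvk, mul_assoc, ← hvk, hwv]
      exact ih1
  · simp [hw' k (by omega), hv' k (by omega), hv' (k + 1) (by omega)]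

theorem prod_map_Ico_eq_cons (f : ℕ → M) {k r : ℕ} (h : k ≤ r) :
    ((List.Ico k (r + 1)).map f).prod = f k * ((List.Ico (k + 1) (r + 1)).map f).prod := by
  rw [List.Ico.eq_cons (Nat.lt_succ_of_le h), List.map_cons, List.prod_cons]

theorem prod_reverse_map_Ico_eq_cons (f : ℕ → M) {k r : ℕ} (h : k ≤ r) :
    ((List.Ico k (r + 1)).map f).reverse.prod =
      ((List.Ico (k + 1) (r + 1)).map f).reverse.prod * f k := by
  rw [List.Ico.eq_cons (Nat.lt_succ_of_le h), List.map_cons, List.reverse_cons, List.prod_append,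
    List.prod_singleton]

end Words

/-! ### Rowmotion and rowvacuation on a ranked poset -/

section RowvacuationProperties

variable {P : Type*} [PartialOrder P] [Fintype P] [GradeMinOrder ℕ P]

/-- The composition of order toggles that corresponds to `partialRow P k`. -/
def orderPartialRow (P : Type*) [PartialOrder P] [Fintype P] [GradeMinOrder ℕ P] (k : ℕ) :
    Function.End (UpperSet P) :=
  ((List.Ico k (posetRank P + 1)).map orderToggle).prod

/-- The composition of order toggles that corresponds to the part of rowvacuation that starts with
`partialRow P k`. -/
def orderPartialRowvacuation (P : Type*) [PartialOrder P] [Fintype P] [GradeMinOrder ℕ P] (k : ℕ) :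
    Function.End (UpperSet P) :=
  ((List.Ico k (posetRank P + 1)).map (orderPartialRow P)).reverse.prod

theorem orderPartialRowvacuation_spec (k : ℕ) :
    orderPartialRowvacuation P k * orderPartialRowvacuation P k = 1 ∧
      orderPartialRow P k * orderPartialRowvacuation P k = orderPartialRowvacuation P (k + 1) :=
  involution_words orderToggle (orderPartialRow P) (orderPartialRowvacuation P) (posetRank P)
    orderToggle_mul_self (fun _ _ h => orderToggle_commute h)
    (fun _ h => prod_map_Ico_eq_cons _ h)
    (fun k h => by simp [orderPartialRow, List.Ico.eq_nil_of_le (show posetRank P + 1 ≤ k from h)])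
    (fun _ h => prod_reverse_map_Ico_eq_cons _ h)
    (fun k h => by
      simp [orderPartialRowvacuation, List.Ico.eq_nil_of_le (show posetRank P + 1 ≤ k from h)]) k

theorem partialRow_levelAntichain {k : ℕ} (hk : k ≤ posetRank P + 1) (U : UpperSet P) :
    partialRow P k (levelAntichain k U) = levelAntichain (posetRank P + 1) U := by
  induction hk using Nat.decreasingInduction with
  | self => simp only [partialRow, List.Ico.self_empty, List.map_nil, List.reverse_nil,
      List.prod_nil]; rfl
  | of_succ k hk ih =>
    rw [partialRow, prod_reverse_map_Ico_eq_cons _ (Nat.le_of_lt_succ hk)]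
    change partialRow P (k + 1) (rankToggle P k (levelAntichain k U)) = _
    rw [rankToggle_levelAntichain, ih]

theorem levelAntichain_orderPartialRow {k : ℕ} (hk : k ≤ posetRank P + 1) (U : UpperSet P) :
    levelAntichain k (orderPartialRow P k U) = levelAntichain (posetRank P + 1) U := by
  induction hk using Nat.decreasingInduction with
  | self => simp only [orderPartialRow, List.Ico.self_empty, List.map_nil, List.prod_nil]; rfl
  | of_succ k hk ih =>
    rw [orderPartialRow, prod_map_Ico_eq_cons _ (Nat.le_of_lt_succ hk)]
    change levelAntichain k (orderToggle k (orderPartialRow P (k + 1) U)) = _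
    rw [← levelAntichain_succ_orderToggle]
    have h : orderToggle k (orderToggle k (orderPartialRow P (k + 1) U)) =
        orderPartialRow P (k + 1) U := congrFun (orderToggle_mul_self k) _
    rw [h]
    exact ih

/-- The antichain of minimal elements of an upper set. -/
noncomputable def minimalAntichain (U : UpperSet P) : Antichains P :=
  levelAntichain (posetRank P + 1) U

theorem mem_minimalAntichain {U : UpperSet P} {x : P} :
    x ∈ (minimalAntichain U).1 ↔ Minimal (· ∈ U) x := by
  have := grade_le_posetRank x
  rw [minimalAntichain, mem_levelAntichain]
  constructor
  · rintro (h | h)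
    · exact h.2
    · omega
  · exact fun h => Or.inl ⟨by omega, h⟩

theorem minimalAntichain_upperClosure (A : Antichains P) :
    minimalAntichain (upperClosure (A.1 : Set P)) = A := by
  refine Subtype.ext (Finset.ext fun x => ?_)
  rw [mem_minimalAntichain]
  constructor
  · intro h
    obtain ⟨a, ha, hax⟩ := mem_upperClosure.1 h.prop
    rw [← h.eq_of_le (subset_upperClosure ha) hax]
    exact ha
  · intro hx
    refine ⟨subset_upperClosure hx, fun y hy hyx => ?_⟩
    obtain ⟨a, ha, hay⟩ := mem_upperClosure.1 hy
    rwa [← A.2.eq ha hx (hay.trans hyx)]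

/-- The minimal antichain of `U` is the level-`k` antichain of `orderPartialRow P k U`; the rank
toggles then raise the level from `k` to the top without changing that upper set. Note that the
order toggles run in the opposite direction, from the top rank down to `k`. -/
theorem partialRow_minimalAntichain (k : ℕ) (U : UpperSet P) :
    partialRow P k (minimalAntichain U) = minimalAntichain (orderPartialRow P k U) := by
  by_cases hk : k ≤ posetRank P + 1
  · rw [minimalAntichain, ← levelAntichain_orderPartialRow hk, partialRow_levelAntichain hk]
    rfl
  · rw [partialRow, orderPartialRow, List.Ico.eq_nil_of_le (by omega)]
    rfl

theorem rowvacuation_minimalAntichain (U : UpperSet P) :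
    rowvacuation P (minimalAntichain U) = minimalAntichain (orderPartialRowvacuation P 0 U) := by
  have key : ∀ (l : List ℕ) (U : UpperSet P),
      (l.map (partialRow P)).reverse.prod (minimalAntichain U) =
        minimalAntichain ((l.map (orderPartialRow P)).reverse.prod U) := by
    intro l
    induction l with
    | nil => intro U; rfl
    | cons k l ih =>
      intro U
      simp only [List.map_cons, List.reverse_cons, List.prod_append, List.prod_singleton]
      change (l.map (partialRow P)).reverse.prod (partialRow P k (minimalAntichain U)) = _
      rw [partialRow_minimalAntichain, ih]
      rfl
  rw [rowvacuation, key, orderPartialRowvacuation, List.Ico.zero_bot]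

theorem rowvacuation_rowvacuation (A : Antichains P) : rowvacuation P (rowvacuation P A) = A := by
  rw [← minimalAntichain_upperClosure A, rowvacuation_minimalAntichain,
    rowvacuation_minimalAntichain]
  exact congrArg minimalAntichain (congrFun (orderPartialRowvacuation_spec 0).1 _)

theorem orderPartialRowvacuation_zero :
    orderPartialRowvacuation P 0 = orderPartialRowvacuation P 1 * orderPartialRow P 0 :=
  prod_reverse_map_Ico_eq_cons _ (Nat.zero_le _)

theorem row_rowvacuation_row (A : Antichains P) :
    partialRow P 0 (rowvacuation P (partialRow P 0 A)) = rowvacuation P A := by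
  rw [← minimalAntichain_upperClosure A, partialRow_minimalAntichain,
    rowvacuation_minimalAntichain, partialRow_minimalAntichain, rowvacuation_minimalAntichain]
  refine congrArg minimalAntichain (congrFun (?_ : orderPartialRow P 0 *
    (orderPartialRowvacuation P 0 * orderPartialRow P 0) = orderPartialRowvacuation P 0) _)
  rw [← mul_assoc, (orderPartialRowvacuation_spec 0).2, ← orderPartialRowvacuation_zero]

/-- At level 0 the antichain consists of the maximal elements of the complement of an upper set, so
`A` is the level-0 antichain of the complement of its lower closure; raising the level to the top
yields the minimal elements of that complement. -/
theorem mem_row {A : Antichains P} {x : P} :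
    x ∈ (partialRow P 0 A).1 ↔
      x ∉ lowerClosure (A.1 : Set P) ∧ ∀ y < x, y ∈ lowerClosure (A.1 : Set P) := by
  have hA : levelAntichain 0 (lowerClosure (A.1 : Set P)).compl = A := by
    refine Subtype.ext (Finset.ext fun x => ?_)
    rw [mem_levelAntichain]
    simp only [Nat.not_lt_zero, false_and, Nat.zero_le, true_and, false_or, LowerSet.mem_compl_iff,
      not_not]
    constructor
    · intro h
      obtain ⟨a, ha, hxa⟩ := mem_lowerClosure.1 h.prop
      rw [h.eq_of_le (subset_lowerClosure ha) hxa]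
      exact ha
    · intro hx
      refine ⟨subset_lowerClosure hx, fun y hy hxy => ?_⟩
      obtain ⟨a, ha, hya⟩ := mem_lowerClosure.1 hy
      rwa [A.2.eq hx ha (hxy.trans hya)]
  conv_lhs => rw [← hA, partialRow_levelAntichain (Nat.zero_le _)]
  change x ∈ (minimalAntichain _).1 ↔ _
  rw [mem_minimalAntichain]
  simp only [minimal_iff_forall_lt, LowerSet.mem_compl_iff, not_not]

/-- Only the first factor of rowvacuation toggles at grade 0. The later order toggles leave the
membership of `x` alone, so it is settled by a single application of `Row`. -/
theorem mem_rowvacuation_iff_of_grade_eq_zero {x : P} (hx : grade ℕ x = 0) (A : Antichains P) :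
    x ∈ (rowvacuation P A).1 ↔ x ∉ lowerClosure (A.1 : Set P) := by
  have hmin : ∀ y, ¬ y < x := fun y hy => by
    have := grade_strictMono (𝕆 := ℕ) hy
    omega
  have hrow : x ∈ (partialRow P 0 A).1 ↔ x ∉ lowerClosure (A.1 : Set P) := by
    rw [mem_row]
    exact and_iff_left fun y hy => absurd hy (hmin y)
  rw [← hrow, ← minimalAntichain_upperClosure A, partialRow_minimalAntichain,
    rowvacuation_minimalAntichain, mem_minimalAntichain, mem_minimalAntichain,
    minimal_iff_forall_lt, minimal_iff_forall_lt, and_iff_left fun y hy => absurd hy (hmin y),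
    and_iff_left fun y hy => absurd hy (hmin y), orderPartialRowvacuation_zero]
  change x ∈ orderPartialRowvacuation P 1 (orderPartialRow P 0 _) ↔ _
  generalize orderPartialRow P 0 (upperClosure (A.1 : Set P)) = U
  let S : Submonoid (Function.End (UpperSet P)) :=
    { carrier := {f | ∀ U, x ∈ f U ↔ x ∈ U}
      mul_mem' := fun {f g} hf hg U => (hf (g U)).trans (hg U)
      one_mem' := fun U => Iff.rfl }
  refine (?_ : orderPartialRowvacuation P 1 ∈ S) U
  refine Submonoid.list_prod_mem _ fun f hf => ?_
  obtain ⟨k, hk, rfl⟩ := List.mem_map.1 (List.mem_reverse.1 hf)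
  refine Submonoid.list_prod_mem _ fun g hg => ?_
  obtain ⟨l, hl, rfl⟩ := List.mem_map.1 hg
  rw [List.Ico.mem] at hk hl
  exact fun U => mem_orderToggle_of_ne (by omega) U

theorem rowvacuation_invariant (e : P ≃o P) (he : ∀ x, grade ℕ (e x) = grade ℕ x)
    (A : Antichains P) (hA : ∀ x, e x ∈ A.1 ↔ x ∈ A.1) (x : P) :
    e x ∈ (rowvacuation P A).1 ↔ x ∈ (rowvacuation P A).1 := by
  let S : Submonoid (Function.End (UpperSet P)) :=
    { carrier := {f | ∀ U : UpperSet P, (∀ x, e x ∈ U ↔ x ∈ U) → ∀ x, e x ∈ f U ↔ x ∈ f U}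
      mul_mem' := fun {f g} hf hg U hU => hf (g U) (hg U hU)
      one_mem' := fun U hU => hU }
  have hcov : ∀ (U : UpperSet P), (∀ x, e x ∈ U ↔ x ∈ U) → ∀ k x,
      e x ∈ orderToggle k U ↔ x ∈ orderToggle k U := by
    intro U hU k x
    by_cases hk : grade ℕ x = k
    · rw [mem_orderToggle_of_eq hk, mem_orderToggle_of_eq ((he x).trans hk), e.surjective.exists,
        e.surjective.forall]
      simp only [hU, apply_covBy_apply_iff]
    · rw [mem_orderToggle_of_ne hk, mem_orderToggle_of_ne (by rwa [he]), hU]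
  have hS : orderPartialRowvacuation P 0 ∈ S := by
    refine Submonoid.list_prod_mem _ fun f hf => ?_
    obtain ⟨k, -, rfl⟩ := List.mem_map.1 (List.mem_reverse.1 hf)
    refine Submonoid.list_prod_mem _ fun g hg => ?_
    obtain ⟨l, -, rfl⟩ := List.mem_map.1 hg
    exact fun U hU => hcov U hU l
  rw [← minimalAntichain_upperClosure A, rowvacuation_minimalAntichain, mem_minimalAntichain,
    mem_minimalAntichain, minimal_iff_forall_lt, minimal_iff_forall_lt, e.surjective.forall]
  have h := hS (upperClosure (A.1 : Set P)) fun x => by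
    simp only [mem_upperClosure]
    rw [e.surjective.exists]
    simp only [Finset.mem_coe, hA, e.le_iff_le]
  simp only [h, e.lt_iff_lt]

end RowvacuationProperties

/-! ### The root order in coordinates -/

namespace PosRootD

variable {n : ℕ}

/-- The nonnegative integer combinations of simple roots. -/
def rootCone (n : ℕ) : AddSubmonoid (Fin n → ℝ) where
  carrier := {v | ∃ c : Fin n → ℕ, v = ∑ i, c i • simple n i}
  zero_mem' := ⟨0, by simp⟩
  add_mem' := by
    rintro _ _ ⟨f, rfl⟩ ⟨g, rfl⟩
    exact ⟨f + g, by simp only [Pi.add_apply, add_smul, Finset.sum_add_distrib]⟩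

theorem le_iff_sub_mem {a b : PosRootD n} : a ≤ b ↔ b.vec - a.vec ∈ rootCone n := Iff.rfl

theorem simple_mem_rootCone (i : Fin n) : simple n i ∈ rootCone n :=
  ⟨Pi.single i 1, by simp [Pi.single_apply]⟩

theorem single_sub_single_mem {i j : ℕ} (hij : i ≤ j) (hj : j < n) :
    (Pi.single ⟨i, by omega⟩ 1 - Pi.single ⟨j, hj⟩ 1 : Fin n → ℝ) ∈ rootCone n := by
  induction j, hij using Nat.le_induction with
  | base => rw [sub_self]; exact zero_mem _
  | succ j hij ih =>
    have h := add_mem (ih (by omega)) (simple_mem_rootCone (n := n) ⟨j, by omega⟩)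
    rw [simple_of_lt (k := ⟨j + 1, hj⟩) rfl] at h
    convert h using 1
    abel

theorem single_add_single_mem {i j : ℕ} (hij : i < j) (hj : j < n) :
    (Pi.single ⟨i, by omega⟩ 1 + Pi.single ⟨j, hj⟩ 1 : Fin n → ℝ) ∈ rootCone n := by
  have h := add_mem (add_mem
    (single_sub_single_mem (n := n) (i := i) (j := n - 2) (by omega) (by omega))
    (single_sub_single_mem (n := n) (i := j) (j := n - 1) (by omega) (by omega)))
    (simple_mem_rootCone ⟨n - 1, by omega⟩)
  rw [simple_last (k := ⟨n - 2, by omega⟩) (by simp only; omega) (by simp only; omega)] at h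
  convert h using 1
  abel

/-- The hypotheses on `g` say that it pairs nonnegatively with every simple root. Such functionals
serve to refute `a ≤ b`. -/
theorem dotProduct_le_of_le {a b : PosRootD n} (h : a ≤ b) (g : ℕ → ℝ)
    (hg : ∀ i, i + 1 < n → g (i + 1) ≤ g i) (hlast : 0 ≤ g (n - 2) + g (n - 1)) :
    a.vec ⬝ᵥ (fun k => g k) ≤ b.vec ⬝ᵥ (fun k => g k) := by
  have hn := a.two_le
  obtain ⟨c, hc⟩ := h
  have hb : b.vec = a.vec + ∑ i, c i • simple n i := by rw [← hc]; abel
  rw [hb, add_dotProduct, sum_dotProduct]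
  refine le_add_of_nonneg_right (Finset.sum_nonneg fun i _ => ?_)
  rw [smul_dotProduct]
  refine nsmul_nonneg ?_ _
  rcases simple_cases hn i with ⟨k, hk, e⟩ | ⟨k, hk, hi, e⟩ <;> rw [e]
  · rw [sub_dotProduct, single_one_dotProduct, single_one_dotProduct, hk]
    have := hg i (by omega)
    linarith
  · rw [add_dotProduct, single_one_dotProduct, single_one_dotProduct]
    have h1 : (k : ℕ) = n - 2 := by omega
    have h2 : (i : ℕ) = n - 1 := by omega
    rwa [h1, h2]

theorem minus_le_minus {i j k l : Fin n} (hij : i < j) (hkl : k < l) :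
    (⟨i, j, hij, false⟩ : PosRootD n) ≤ ⟨k, l, hkl, false⟩ ↔ k.1 ≤ i.1 ∧ j.1 ≤ l.1 := by
  have hij' := Fin.lt_def.1 hij
  have hkl' := Fin.lt_def.1 hkl
  constructor
  · intro h
    constructor
    · by_contra hcon
      have := dotProduct_le_of_le h (fun x => if x ≤ i.1 then 1 else 0)
        (fun x _ => by split_ifs <;> first | omega | norm_num)
        (by positivity)
      simp only [vec_minus, sub_dotProduct, single_one_dotProduct] at this
      split_ifs at this <;> first | omega | linarith
    · by_contra hcon
      have := dotProduct_le_of_le h (fun x => if x < j.1 then 1 else 0)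
        (fun x _ => by split_ifs <;> first | omega | norm_num)
        (by positivity)
      simp only [vec_minus, sub_dotProduct, single_one_dotProduct] at this
      split_ifs at this <;> first | omega | linarith
  · rintro ⟨h1, h2⟩
    rw [le_iff_sub_mem]
    convert add_mem (single_sub_single_mem h1 i.2) (single_sub_single_mem h2 l.2) using 1
    simp only [vec_minus]
    abel

theorem minus_le_plus {i j k l : Fin n} (hij : i < j) (hkl : k < l) :
    (⟨i, j, hij, false⟩ : PosRootD n) ≤ ⟨k, l, hkl, true⟩ ↔
      k.1 ≤ i.1 ∧ (j.1 + 1 < n ∨ l.1 + 1 < n) := by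
  have hij' := Fin.lt_def.1 hij
  have hkl' := Fin.lt_def.1 hkl
  constructor
  · intro h
    constructor
    · by_contra hcon
      have := dotProduct_le_of_le h (fun x => if x ≤ i.1 then 1 else 0)
        (fun x _ => by split_ifs <;> first | omega | norm_num)
        (by positivity)
      simp only [vec_minus, vec_plus, add_dotProduct, sub_dotProduct, single_one_dotProduct] at this
      split_ifs at this <;> first | omega | linarith
    · by_contra hcon
      -- This functional vanishes on the simple root `e_{n-2} + e_{n-1}`. If both second indices are
      -- `n - 1`, it gives 2 on the left root and 0 on the right one.
      have := dotProduct_le_of_le h (fun x => if x + 1 < n then 1 else -1)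
        (fun x _ => by split_ifs <;> first | omega | norm_num)
        (by split_ifs <;> first | omega | norm_num)
      simp only [vec_minus, vec_plus, add_dotProduct, sub_dotProduct, single_one_dotProduct] at this
      split_ifs at this <;> first | omega | linarith
  · rintro ⟨h1, h2⟩
    rw [le_iff_sub_mem]
    have h3 : (Pi.single l 1 + Pi.single j 1 : Fin n → ℝ) ∈ rootCone n := by
      rcases lt_trichotomy l.1 j.1 with h | h | h
      · exact single_add_single_mem h j.2
      · have hlj : l = j := Fin.ext h
        subst hlj
        have hl : l.1 + 1 < n := by tauto
        -- Here `2 e_l = (e_l - e_{n-1}) + (e_l + e_{n-1})`.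
        convert add_mem (single_sub_single_mem (n := n) (i := l) (j := n - 1) (by omega) (by omega))
          (single_add_single_mem (n := n) (i := l) (j := n - 1) (by omega) (by omega)) using 1
        simp only [Fin.eta]
        abel
      · rw [add_comm]
        exact single_add_single_mem h l.2
    convert add_mem (single_sub_single_mem h1 i.2) h3 using 1
    simp only [vec_minus, vec_plus]
    abel

theorem not_plus_le_minus {i j k l : Fin n} (hij : i < j) (hkl : k < l) :
    ¬ (⟨i, j, hij, true⟩ : PosRootD n) ≤ ⟨k, l, hkl, false⟩ := by
  intro h
  have := dotProduct_le_of_le h (fun _ => 1) (fun _ _ => le_rfl) (by norm_num)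
  simp only [vec_minus, vec_plus, add_dotProduct, sub_dotProduct, single_one_dotProduct] at this
  linarith

theorem plus_le_plus {i j k l : Fin n} (hij : i < j) (hkl : k < l) :
    (⟨i, j, hij, true⟩ : PosRootD n) ≤ ⟨k, l, hkl, true⟩ ↔ k.1 ≤ i.1 ∧ l.1 ≤ j.1 := by
  have hij' := Fin.lt_def.1 hij
  have hkl' := Fin.lt_def.1 hkl
  constructor
  · intro h
    constructor
    · by_contra hcon
      have := dotProduct_le_of_le h (fun x => if x ≤ i.1 then 1 else 0)
        (fun x _ => by split_ifs <;> first | omega | norm_num)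
        (by positivity)
      simp only [vec_plus, add_dotProduct, single_one_dotProduct] at this
      split_ifs at this <;> first | omega | linarith
    · by_contra hcon
      have := dotProduct_le_of_le h (fun x => if x ≤ j.1 then 1 else 0)
        (fun x _ => by split_ifs <;> first | omega | norm_num)
        (by positivity)
      simp only [vec_plus, add_dotProduct, single_one_dotProduct] at this
      split_ifs at this <;> first | omega | linarith
  · rintro ⟨h1, h2⟩
    rw [le_iff_sub_mem]
    convert add_mem (single_sub_single_mem h1 i.2) (single_sub_single_mem h2 j.2) using 1
    simp only [vec_plus]
    abel

/-- The root order in terms of indices. -/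
theorem le_iff (a b : PosRootD n) :
    a ≤ b ↔ b.i.1 ≤ a.i.1 ∧
      ((a.plus = false ∧ b.plus = false ∧ a.j.1 ≤ b.j.1) ∨
        (a.plus = false ∧ b.plus = true ∧ (a.j.1 + 1 < n ∨ b.j.1 + 1 < n)) ∨
        (a.plus = true ∧ b.plus = true ∧ b.j.1 ≤ a.j.1)) := by
  obtain ⟨i, j, hij, s⟩ := a
  obtain ⟨k, l, hkl, t⟩ := b
  cases s <;> cases t
  · simp [minus_le_minus]
  · simp [minus_le_plus]
  · simp [not_plus_le_minus]
  · simp [plus_le_plus]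

theorem eq_iff (a b : PosRootD n) : a = b ↔ a.i.1 = b.i.1 ∧ a.j.1 = b.j.1 ∧ a.plus = b.plus := by
  obtain ⟨i, j, hij, s⟩ := a
  obtain ⟨k, l, hkl, t⟩ := b
  simp [Fin.ext_iff]

end PosRootD

/-! ### Detecting elements of an antichain and of its image under `Row` by pushes out of the lower
closure -/

section Shift

variable {P : Type*} [PartialOrder P]

/-- Among the pushes `f x ↦ g x` leaving `I(A)`, take one with `f x` maximal. If `f x` were strictly
below some `a ∈ A`, then by `hup` either `g x ≤ a`, or a larger `f x'` lies in `I(A)` and is also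
pushed out by `hmono`. Together with the next lemma, this relates `f` in `A` to `g` in `Row A`. -/
theorem exists_mem_iff_exists_push {ι : Type*} [Finite ι] (f g : ι → P) (A : Antichains P)
    (hlt : ∀ x, f x < g x) (hmono : ∀ x x', f x < f x' → g x ≤ g x')
    (hup : ∀ x z, f x < z → g x ≤ z ∨ ∃ x', f x < f x' ∧ f x' ≤ z) :
    (∃ x, f x ∈ A.1) ↔
      ∃ x, f x ∈ lowerClosure (A.1 : Set P) ∧ g x ∉ lowerClosure (A.1 : Set P) := by
  constructor
  · rintro ⟨x, hx⟩
    refine ⟨x, subset_lowerClosure hx, fun h => ?_⟩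
    obtain ⟨a, ha, hxa⟩ := mem_lowerClosure.1 h
    have := (hlt x).trans_le hxa
    exact this.ne (A.2.eq hx ha this.le)
  · intro h
    obtain ⟨x, ⟨hx, hgx⟩, hmax⟩ := (Set.toFinite {x | f x ∈ lowerClosure (A.1 : Set P) ∧
      g x ∉ lowerClosure (A.1 : Set P)}).exists_maximalFor f _ h
    refine ⟨x, ?_⟩
    obtain ⟨a, ha, hxa⟩ := mem_lowerClosure.1 hx
    rcases eq_or_lt_of_le hxa with h1 | h1
    · rw [h1]; exact ha
    · exfalso
      rcases hup x a h1 with h2 | ⟨x', h2, h3⟩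
      · exact hgx (mem_lowerClosure.2 ⟨a, ha, h2⟩)
      · exact (hmax ⟨mem_lowerClosure.2 ⟨a, ha, h3⟩, fun h4 =>
          hgx ((lowerClosure (A.1 : Set P)).lower (hmono x x' h2) h4)⟩ h2.le).not_gt h2

variable [Fintype P] [GradeMinOrder ℕ P]

/-- Dually, a push with `f x` minimal has everything strictly below `g x` inside `I(A)`, so `g x` is
a minimal non-member. -/
theorem exists_mem_row_iff_exists_push {ι : Type*} [Finite ι] (f g : ι → P) (A : Antichains P)
    (hlt : ∀ x, f x < g x)
    (hdown : ∀ x z, z < g x → z ∈ lowerClosure (A.1 : Set P) ∨ z ≤ f x ∨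
      ∃ x', f x' < f x ∧ z ≤ g x') :
    (∃ x, g x ∈ (partialRow P 0 A).1) ↔
      ∃ x, f x ∈ lowerClosure (A.1 : Set P) ∧ g x ∉ lowerClosure (A.1 : Set P) := by
  constructor
  · rintro ⟨x, hx⟩
    rw [mem_row] at hx
    exact ⟨x, hx.2 _ (hlt x), hx.1⟩
  · intro h
    obtain ⟨x, ⟨hx, hgx⟩, hmin⟩ := (Set.toFinite {x | f x ∈ lowerClosure (A.1 : Set P) ∧
      g x ∉ lowerClosure (A.1 : Set P)}).exists_minimalFor f _ h
    refine ⟨x, mem_row.2 ⟨hgx, fun z hz => ?_⟩⟩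
    rcases hdown x z hz with h1 | h1 | ⟨x', h1, h2⟩
    · exact h1
    · exact (lowerClosure (A.1 : Set P)).lower h1 hx
    · refine (lowerClosure (A.1 : Set P)).lower h2 (by_contra fun h3 => ?_)
      exact (hmin ⟨(lowerClosure (A.1 : Set P)).lower h1.le hx, h3⟩ h1.le).not_gt h1

/-- Applied to `R(Row A)`, whose image under `Row` is `R(A)`, this supplies the simple roots that
the shift lemmas require in the lower closure. -/
theorem mem_lowerClosure_of_notMem_row {A : Antichains P} {x : P} (hx : grade ℕ x = 0)
    (h : x ∉ (partialRow P 0 A).1) : x ∈ lowerClosure (A.1 : Set P) := by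
  by_contra h1
  refine h (mem_row.2 ⟨h1, fun y hy => ?_⟩)
  have := grade_strictMono (𝕆 := ℕ) hy
  omega

end Shift

/-! ### Rows and columns of roots, and their shift under `Row` -/

namespace PosRootD

variable {n : ℕ}

/-- The root `e_i ± e_j` for natural numbers `i < j < n`. -/
def root (i j : ℕ) (s : Bool) (hij : i < j) (hj : j < n) : PosRootD n :=
  ⟨⟨i, by omega⟩, ⟨j, hj⟩, hij, s⟩

theorem i_lt_j (a : PosRootD n) : a.i.1 < a.j.1 := a.lt

theorem root_i {i j : ℕ} {s : Bool} {hij : i < j} {hj : j < n} :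
    (root i j s hij hj).i.1 = i := rfl

theorem root_j {i j : ℕ} {s : Bool} {hij : i < j} {hj : j < n} :
    (root i j s hij hj).j.1 = j := rfl

theorem root_plus {i j : ℕ} {s : Bool} {hij : i < j} {hj : j < n} :
    (root i j s hij hj).plus = s := rfl

theorem grade_eq_rk (a : PosRootD n) : grade ℕ a = a.rk := rfl

theorem root_le_iff {i j : ℕ} {s : Bool} {hij : i < j} {hj : j < n} {b : PosRootD n} :
    root i j s hij hj ≤ b ↔ b.i.1 ≤ i ∧
      ((s = false ∧ b.plus = false ∧ j ≤ b.j.1) ∨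
        (s = false ∧ b.plus = true ∧ (j + 1 < n ∨ b.j.1 + 1 < n)) ∨
        (s = true ∧ b.plus = true ∧ b.j.1 ≤ j)) := le_iff _ _

theorem lt_iff (a b : PosRootD n) :
    a < b ↔ (b.i.1 ≤ a.i.1 ∧
      ((a.plus = false ∧ b.plus = false ∧ a.j.1 ≤ b.j.1) ∨
        (a.plus = false ∧ b.plus = true ∧ (a.j.1 + 1 < n ∨ b.j.1 + 1 < n)) ∨
        (a.plus = true ∧ b.plus = true ∧ b.j.1 ≤ a.j.1))) ∧
      ¬ (a.i.1 = b.i.1 ∧ a.j.1 = b.j.1 ∧ a.plus = b.plus) := by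
  rw [lt_iff_le_and_ne, le_iff, ne_eq, eq_iff]

theorem grade_root_succ {a : ℕ} (ha : a + 1 < n) :
    grade ℕ (root a (a + 1) false (Nat.lt_succ_self a) ha : PosRootD n) = 0 := by
  rw [grade_eq_rk]
  simp [rk, root]

theorem grade_root_last {a : ℕ} (ha : a + 2 = n) :
    grade ℕ (root a (a + 1) true (Nat.lt_succ_self a) (by omega) : PosRootD n) = 0 := by
  rw [grade_eq_rk]
  simp only [rk, root, if_true]
  omega

/-- The antichain contains some `e_i - e_{a+1}`. -/
def MeetsColumn (a : ℕ) (A : Antichains (PosRootD n)) : Prop :=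
  ∃ x ∈ A.1, x.plus = false ∧ x.j.1 = a + 1

/-- The antichain contains some `e_a ± e_j` or some `e_i + e_{a+1}`. -/
def MeetsRow (a : ℕ) (A : Antichains (PosRootD n)) : Prop :=
  ∃ x ∈ A.1, x.i.1 = a ∨ (x.plus = true ∧ x.j.1 = a + 1)

/-- Push `e_i - e_{a+1}` to `e_i - e_{a+2}`. Column `a + 1` has one root that is not such a target,
namely `α_{a+1}`, and `h` keeps it out of `Row A`. -/
theorem meetsColumn_succ_row {a : ℕ} (ha : a + 3 < n) (A : Antichains (PosRootD n))
    (h : root (a + 1) (a + 2) false (by omega) (by omega) ∈ lowerClosure (A.1 : Set (PosRootD n))) :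
    MeetsColumn (a + 1) (partialRow _ 0 A) ↔ MeetsColumn a A := by
  let f : Fin (a + 1) → PosRootD n := fun i => root i (a + 1) false (by omega) (by omega)
  let g : Fin (a + 1) → PosRootD n := fun i => root i (a + 2) false (by omega) (by omega)
  have hf : ∀ i, (f i).i.1 = i.1 ∧ (f i).j.1 = a + 1 ∧ (f i).plus = false := fun i => ⟨rfl, rfl, rfl⟩
  have hg : ∀ i, (g i).i.1 = i.1 ∧ (g i).j.1 = a + 2 ∧ (g i).plus = false := fun i => ⟨rfl, rfl, rfl⟩
  have hlt : ∀ x, f x < g x := fun x => by rw [lt_iff]; grind [root_i, root_j, root_plus, i_lt_j]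
  have e1 : MeetsColumn a A ↔ ∃ x, f x ∈ A.1 := by
    constructor
    · rintro ⟨x, hx, h1, h2⟩
      have := x.i_lt_j
      have : f ⟨x.i.1, by omega⟩ = x := by rw [eq_iff]; grind [root_i, root_j, root_plus, i_lt_j]
      exact ⟨_, this ▸ hx⟩
    · rintro ⟨x, hx⟩
      exact ⟨_, hx, rfl, rfl⟩
  have e2 : MeetsColumn (a + 1) (partialRow _ 0 A) ↔ ∃ x, g x ∈ (partialRow _ 0 A).1 := by
    constructor
    · rintro ⟨x, hx, h1, h2⟩
      have := x.i_lt_j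
      have hxi : x.i.1 ≠ a + 1 := by
        intro h3
        have : x = root (a + 1) (a + 2) false (by omega) (by omega) := by
          rw [eq_iff]; exact ⟨h3, h2, h1⟩
        exact (mem_row.1 hx).1 (this ▸ h)
      have : g ⟨x.i.1, by omega⟩ = x := by rw [eq_iff]; grind [root_i, root_j, root_plus, i_lt_j]
      exact ⟨_, this ▸ hx⟩
    · rintro ⟨x, hx⟩
      exact ⟨_, hx, rfl, rfl⟩
  rw [e1, e2, exists_mem_row_iff_exists_push f g A hlt, exists_mem_iff_exists_push f g A hlt]
  · intro x x'
    rw [lt_iff, le_iff]; grind [root_i, root_j, root_plus, i_lt_j]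
  · intro x z hz
    by_cases hzi : z.i.1 < x.1
    · refine Or.inr ⟨⟨z.i.1, by omega⟩, ?_⟩
      rw [lt_iff] at *
      rw [le_iff]
      grind [root_i, root_j, root_plus, i_lt_j]
    · left
      have := z.i_lt_j
      rw [lt_iff] at hz
      rw [le_iff]
      grind [root_i, root_j, root_plus, i_lt_j]
  · intro x z hz
    by_cases h1 : z.i.1 = a + 1
    · left
      have := z.i_lt_j
      have : z = root (a + 1) (a + 2) false (by omega) (by omega) := by
        rw [eq_iff, root]; rw [lt_iff] at hz; grind [root_i, root_j, root_plus, i_lt_j]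
      rw [this]; exact h
    · right
      by_cases h2 : z.j.1 ≤ a + 1
      · left; rw [lt_iff] at hz; rw [le_iff]; grind [root_i, root_j, root_plus, i_lt_j]
      · have := z.i_lt_j
        refine Or.inr ⟨⟨z.i.1, by rw [lt_iff] at hz; grind [root_i, root_j, root_plus, i_lt_j]⟩, ?_⟩
        rw [lt_iff] at *
        rw [le_iff]
        grind [root_i, root_j, root_plus, i_lt_j]

/-- The pushes add `α_a` to `e_{a+1} ± e_j` and `α_{a+1}` to `e_i + e_{a+2}` with `i ≤ a`. They
reach every root of row `a` except `α_a`, which `h` keeps out of `Row A`. -/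
theorem meetsRow_row {a : ℕ} (ha : a + 3 < n) (A : Antichains (PosRootD n))
    (h : root a (a + 1) false (by omega) (by omega) ∈ lowerClosure (A.1 : Set (PosRootD n))) :
    MeetsRow a (partialRow _ 0 A) ↔ MeetsRow (a + 1) A := by
  let E := {x : PosRootD n // x.i.1 = a + 1 ∨ (x.plus = true ∧ x.j.1 = a + 2)}
  let f : E → PosRootD n := Subtype.val
  have hex : ∀ x : E, ∃ y : PosRootD n,
      (x.1.i.1 = a + 1 → y.i.1 = a ∧ y.j.1 = x.1.j.1 ∧ y.plus = x.1.plus) ∧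
      (x.1.i.1 ≠ a + 1 → y.i.1 = x.1.i.1 ∧ y.j.1 = a + 1 ∧ y.plus = true) := by
    rintro ⟨x, hx⟩
    have := x.i_lt_j
    by_cases h1 : x.i.1 = a + 1
    · exact ⟨root a x.j.1 x.plus (by omega) x.j.2, fun _ => ⟨rfl, rfl, rfl⟩, fun h => absurd h1 h⟩
    · exact ⟨root x.i.1 (a + 1) true (by omega) (by omega), fun h => absurd h h1,
        fun _ => ⟨rfl, rfl, rfl⟩⟩
  choose g hg using hex
  have hlt : ∀ x, f x < g x := fun x => by
    have h1 := hg x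
    have h2 := x.2
    have h3 := x.1.i_lt_j
    rw [lt_iff]; grind [root_i, root_j, root_plus, i_lt_j]
  have e1 : MeetsRow (a + 1) A ↔ ∃ x, f x ∈ A.1 := by
    constructor
    · rintro ⟨x, hx, h1⟩
      exact ⟨⟨x, h1⟩, hx⟩
    · rintro ⟨x, hx⟩
      exact ⟨_, hx, x.2⟩
  have e2 : MeetsRow a (partialRow _ 0 A) ↔ ∃ x, g x ∈ (partialRow _ 0 A).1 := by
    constructor
    · rintro ⟨x, hx, h1⟩
      have hlt := x.i_lt_j
      have hne : ¬ (x.i.1 = a ∧ x.j.1 = a + 1 ∧ x.plus = false) := by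
        intro h3
        have : x = root a (a + 1) false (by omega) (by omega) := by
          rw [eq_iff]; exact h3
        exact (mem_row.1 hx).1 (this ▸ h)
      by_cases h2 : x.j.1 = a + 1
      · have hp : x.plus = true := by grind [root_i, root_j, root_plus, i_lt_j]
        let y : E := ⟨root x.i.1 (a + 2) true (by omega) (by omega), Or.inr ⟨rfl, rfl⟩⟩
        have hy : y.1.i.1 = x.i.1 := rfl
        have hgy := (hg y).2 (by omega)
        refine ⟨y, ?_⟩
        have : g y = x := by rw [eq_iff]; grind [root_i, root_j, root_plus, i_lt_j]
        rwa [this]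
      · let y : E := ⟨root (a + 1) x.j.1 x.plus (by omega) x.j.2, Or.inl rfl⟩
        have hy : y.1.i.1 = a + 1 := rfl
        have hy' : y.1.j.1 = x.j.1 ∧ y.1.plus = x.plus := ⟨rfl, rfl⟩
        have hgy := (hg y).1 (by omega)
        refine ⟨y, ?_⟩
        have : g y = x := by rw [eq_iff]; grind [root_i, root_j, root_plus, i_lt_j]
        rwa [this]
    · rintro ⟨x, hx⟩
      refine ⟨_, hx, ?_⟩
      have h1 := hg x
      grind [root_i, root_j, root_plus, i_lt_j]
  rw [e1, e2, exists_mem_row_iff_exists_push f g A hlt, exists_mem_iff_exists_push f g A hlt]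
  · intro x x' hxx
    have h1 := hg x
    have h2 := hg x'
    have h3 := x.2
    have h4 := x'.2
    change x.1 < x'.1 at hxx
    rw [lt_iff] at hxx
    rw [le_iff]
    grind [root_i, root_j, root_plus, i_lt_j]
  · intro x z hz
    by_cases hgz : g x ≤ z
    · exact Or.inl hgz
    right
    have hgx := hg x
    have hxE := x.2
    change x.1 < z at hz
    have h5 := z.i_lt_j
    have h6 := x.1.i_lt_j
    have h7 := z.j.2
    have h8 := x.1.j.2
    rw [le_iff] at hgz
    rw [lt_iff] at hz
    refine ⟨⟨z, ?_⟩, ?_⟩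
    · grind [root_i, root_j, root_plus, i_lt_j]
    · change x.1 < z ∧ z ≤ z
      rw [lt_iff]
      exact ⟨hz, le_rfl⟩
  · intro x z hz
    have hgx := hg x
    have hxE := x.2
    have h5 := z.i_lt_j
    have h6 := x.1.i_lt_j
    have h7 := z.j.2
    have h8 := x.1.j.2
    by_cases hz1 : z.i.1 = a ∧ z.j.1 = a + 1 ∧ z.plus = false
    · left
      have : z = root a (a + 1) false (by omega) (by omega) := by rw [eq_iff]; exact hz1
      rw [this]; exact h
    right
    by_cases hzx : z ≤ f x
    · exact Or.inl hzx
    right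
    change ¬ z ≤ x.1 at hzx
    rw [le_iff] at hzx
    rw [lt_iff] at hz
    by_cases hzj : z.j.1 = a + 1
    · let y : E := ⟨root z.i.1 (a + 2) true (by omega) (by omega), Or.inr ⟨rfl, rfl⟩⟩
      have hy : y.1.i.1 = z.i.1 := rfl
      have hy' : y.1.j.1 = a + 2 ∧ y.1.plus = true := ⟨rfl, rfl⟩
      have hgy := (hg y).2 (by omega)
      refine ⟨y, ?_⟩
      change y.1 < x.1 ∧ _
      rw [lt_iff, le_iff]
      grind [root_i, root_j, root_plus, i_lt_j]
    · have hzi : z.i.1 = a := by grind [root_i, root_j, root_plus, i_lt_j]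
      let y : E := ⟨root (a + 1) z.j.1 z.plus (by omega) z.j.2, Or.inl rfl⟩
      have hy : y.1.i.1 = a + 1 := rfl
      have hy' : y.1.j.1 = z.j.1 ∧ y.1.plus = z.plus := ⟨rfl, rfl⟩
      have hgy := (hg y).1 hy
      refine ⟨y, ?_⟩
      change y.1 < x.1 ∧ _
      rw [lt_iff, le_iff]
      grind [root_i, root_j, root_plus, i_lt_j]

end PosRootD

/-! ### Exchange of rows and columns, and the shift across the fork -/

namespace PosRootD

variable {n : ℕ}

theorem eq_of_le_of_mem {A : Antichains (PosRootD n)} {x y : PosRootD n} (hx : x ∈ A.1)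
    (hy : y ∈ A.1) (h : x ≤ y) : x.i.1 = y.i.1 ∧ x.j.1 = y.j.1 ∧ x.plus = y.plus :=
  (eq_iff x y).1 (A.2.eq hx hy h)

/-- Row `a` of an antichain is empty exactly if column `a` of its rowvacuation is not. -/
theorem meetsRow_iff_not_meetsColumn_rowvacuation {a : ℕ} (ha : a + 2 < n)
    (A : Antichains (PosRootD n)) : MeetsRow a A ↔ ¬ MeetsColumn a (rowvacuation _ A) := by
  induction a generalizing A with
  | zero =>
    have hR := mem_rowvacuation_iff_of_grade_eq_zero (grade_root_succ (n := n) (a := 0) (by omega)) A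
    by_cases h : root 0 (0 + 1) false (by omega) (by omega) ∈ lowerClosure (A.1 : Set (PosRootD n))
    · have h1 : MeetsRow 0 A := by
        obtain ⟨x, hx, hle⟩ := mem_lowerClosure.1 h
        refine ⟨x, hx, Or.inl ?_⟩
        rw [root_le_iff] at hle
        omega
      have h2 : ¬ MeetsColumn 0 (rowvacuation _ A) := by
        rintro ⟨x, hx, hp, hj⟩
        have hxlt := x.i_lt_j
        have : x = root 0 (0 + 1) false (by omega) (by omega) := by
          rw [eq_iff, root_i, root_j, root_plus]
          exact ⟨by omega, hj, hp⟩
        exact hR.1 (this ▸ hx) h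
      exact iff_of_true h1 h2
    -- Every root of row 0 lies above `α_0`, and column 0 consists of `α_0` alone.
    · have h1 : ¬ MeetsRow 0 A := by
        rintro ⟨x, hx, h1⟩
        refine h (mem_lowerClosure.2 ⟨x, hx, ?_⟩)
        rw [root_le_iff]
        grind [i_lt_j]
      have h2 : MeetsColumn 0 (rowvacuation _ A) := ⟨_, hR.2 h, rfl, rfl⟩
      exact iff_of_false h1 (not_not.2 h2)
  | succ b ih =>
    have hR := mem_rowvacuation_iff_of_grade_eq_zero
      (grade_root_succ (n := n) (a := b + 1) (by omega)) A
    have hR' := mem_rowvacuation_iff_of_grade_eq_zero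
      (grade_root_succ (n := n) (a := b) (by omega)) A
    by_cases h : root (b + 1) (b + 1 + 1) false (by omega) (by omega) ∈
        lowerClosure (A.1 : Set (PosRootD n))
    · by_cases h' : root b (b + 1) false (by omega) (by omega) ∈
          lowerClosure (A.1 : Set (PosRootD n))
      -- Row `b + 1` of `A` becomes row `b` of `Row A`, hence by induction the complement of column
      -- `b` of `R(Row A)`, which becomes column `b + 1` of `Row(R(Row A)) = R(A)`.
      · rw [← meetsRow_row (by omega) A h', ih (by omega) (partialRow _ 0 A),
          ← row_rowvacuation_row A, meetsColumn_succ_row (by omega)]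
        refine mem_lowerClosure_of_notMem_row (grade_root_succ _) ?_
        rw [row_rowvacuation_row A]
        exact fun h1 => hR.1 h1 h
      -- An element above `α_{b+1}` but not above `α_b` has first index `b + 1`. On the other side
      -- `α_b ∈ R(A)` excludes every `e_i - e_{b+2}` with `i ≤ b`.
      · have h1 : MeetsRow (b + 1) A := by
          obtain ⟨x, hx, hle⟩ := mem_lowerClosure.1 h
          refine ⟨x, hx, Or.inl ?_⟩
          have hle' : ¬ root b (b + 1) false (by omega) (by omega) ≤ x := fun hle' =>
            h' (mem_lowerClosure.2 ⟨x, hx, hle'⟩)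
          rw [root_le_iff] at hle hle'
          grind [i_lt_j]
        have h2 : ¬ MeetsColumn (b + 1) (rowvacuation _ A) := by
          rintro ⟨x, hx, hp, hj⟩
          have hxlt := x.i_lt_j
          by_cases hi : x.i.1 = b + 1
          · have : x = root (b + 1) (b + 1 + 1) false (by omega) (by omega) := by
              rw [eq_iff, root_i, root_j, root_plus]
              exact ⟨hi, hj, hp⟩
            exact hR.1 (this ▸ hx) h
          · have := eq_of_le_of_mem (hR'.2 h') hx (by
              rw [root_le_iff]
              exact ⟨by omega, Or.inl ⟨rfl, hp, by omega⟩⟩)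
            rw [root_j] at this
            omega
        exact iff_of_true h1 h2
    · have h1 : ¬ MeetsRow (b + 1) A := by
        rintro ⟨x, hx, h1⟩
        refine h (mem_lowerClosure.2 ⟨x, hx, ?_⟩)
        rw [root_le_iff]
        grind [i_lt_j]
      have h2 : MeetsColumn (b + 1) (rowvacuation _ A) := ⟨_, hR.2 h, rfl, rfl⟩
      exact iff_of_false h1 (not_not.2 h2)

/-- The antichain contains a root `e_i ± e_{n-1}` (indices start at zero) with the sign `s`. -/
def MeetsLast (s : Bool) (A : Antichains (PosRootD n)) : Prop :=
  ∃ x ∈ A.1, x.plus = s ∧ x.j.1 + 1 = n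

/-- Both signs occur among the roots `e_i ± e_{n-1}` of the antichain. -/
def MeetsBoth (A : Antichains (PosRootD n)) : Prop := ∀ s, MeetsLast s A

/-- At the fork, `e_i - e_{n-2}` can be pushed to `e_i - e_{n-1}` or to `e_i + e_{n-1}`. Each sign
in `Row A` amounts to a push of that sign; membership of `e_i - e_{n-2}` in `A` amounts to one index
pushed out in both signs. -/
theorem meetsBoth_row {a : ℕ} (ha : a + 3 = n) (A : Antichains (PosRootD n))
    (h : ∀ s, root (a + 1) (a + 2) s (by omega) (by omega) ∈
      lowerClosure (A.1 : Set (PosRootD n))) :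
    MeetsBoth (partialRow _ 0 A) ↔ MeetsColumn a A := by
  let I := lowerClosure (A.1 : Set (PosRootD n))
  let f : Fin (a + 1) → PosRootD n := fun i => root i (a + 1) false (by omega) (by omega)
  let g : Bool → Fin (a + 1) → PosRootD n := fun s i => root i (a + 2) s (by omega) (by omega)
  have hf : ∀ i, (f i).i.1 = i.1 ∧ (f i).j.1 = a + 1 ∧ (f i).plus = false := fun i => ⟨rfl, rfl, rfl⟩
  have hg : ∀ s i, (g s i).i.1 = i.1 ∧ (g s i).j.1 = a + 2 ∧ (g s i).plus = s :=
    fun s i => ⟨rfl, rfl, rfl⟩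
  have hlt : ∀ s x, f x < g s x := fun s x => by
    have h1 := hf x
    have h2 := hg s x
    clear_value f g
    clear h hf hg
    rw [lt_iff]
    cases s <;> grind
  have e2 : ∀ s, MeetsLast s (partialRow _ 0 A) ↔ ∃ x, f x ∈ I ∧ g s x ∉ I := by
    intro s
    rw [← exists_mem_row_iff_exists_push f (g s) A (hlt s)]
    · constructor
      · rintro ⟨x, hx, h1, h2⟩
        have := x.i_lt_j
        have hxi : x.i.1 ≠ a + 1 := by
          intro h3
          have : x = root (a + 1) (a + 2) s (by omega) (by omega) := by
            rw [eq_iff, root_i, root_j, root_plus]; exact ⟨h3, by omega, h1⟩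
          exact (mem_row.1 hx).1 (this ▸ h s)
        have : g s ⟨x.i.1, by omega⟩ = x := by
          rw [eq_iff]; exact ⟨rfl, by rw [(hg _ _).2.1]; omega, h1.symm⟩
        exact ⟨_, this ▸ hx⟩
      · rintro ⟨x, hx⟩
        exact ⟨_, hx, rfl, ha⟩
    · intro x z hz
      have hgx := hg s x
      have hfx := hf x
      have hzlt := z.i_lt_j
      by_cases h1 : z.i.1 = a + 1
      · left
        have : z = root (a + 1) (a + 2) s (by omega) (by omega) := by
          rw [eq_iff, root_i, root_j, root_plus]
          rw [lt_iff] at hz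
          clear h
          grind
        rw [this]; exact h s
      · right
        rw [lt_iff] at hz
        by_cases h2 : z.j.1 ≤ a + 1
        · left
          rw [le_iff]
          clear h
          grind
        · right
          have hzi : z.i.1 < a + 1 := by have := z.j.2; omega
          refine ⟨⟨z.i.1, hzi⟩, ?_⟩
          have h3 := hg s ⟨z.i.1, hzi⟩
          have h4 := hf ⟨z.i.1, hzi⟩
          rw [lt_iff, le_iff]
          clear h
          grind
  have e1 : MeetsColumn a A ↔ ∃ x, f x ∈ I ∧ ∀ s, g s x ∉ I := by
    constructor
    · rintro ⟨x, hx, h1, h2⟩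
      have := x.i_lt_j
      have hfx : f ⟨x.i.1, by omega⟩ = x := by
        rw [eq_iff]; exact ⟨rfl, by rw [(hf _).2.1]; omega, h1.symm⟩
      refine ⟨⟨x.i.1, by omega⟩, hfx ▸ subset_lowerClosure hx, fun s h3 => ?_⟩
      obtain ⟨y, hy, hle⟩ := mem_lowerClosure.1 h3
      have h4 := (hlt s ⟨x.i.1, by omega⟩).trans_le hle
      rw [hfx] at h4
      exact h4.ne (A.2.eq hx hy h4.le)
    · rintro ⟨x, hx, hgx⟩
      obtain ⟨y, hy, hle⟩ := mem_lowerClosure.1 hx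
      refine ⟨y, hy, ?_⟩
      have h1 := fun s => fun hle' => hgx s (mem_lowerClosure.2 ⟨y, hy, hle'⟩)
      have h2 := h1 false
      have h3 := h1 true
      change ¬ root _ _ _ _ _ ≤ y at h2 h3
      change root _ _ _ _ _ ≤ y at hle
      rw [root_le_iff] at h2 h3 hle
      have := y.i_lt_j
      have := y.j.2
      clear h h1 hgx hx e2 hlt hf hg
      grind
  rw [e1]
  constructor
  · intro hb
    obtain ⟨x, hx, hgx⟩ := (e2 false).1 (hb false)
    obtain ⟨y, hy, hgy⟩ := (e2 true).1 (hb true)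
    have anti : ∀ s, ∀ u v : Fin (a + 1), u ≤ v → g s u ∈ I → g s v ∈ I := by
      intro s u v huv
      refine I.lower ?_
      rw [le_iff]
      change u.1 ≤ v.1 ∧ _
      rw [(hg s u).2.1, (hg s v).2.1, (hg s u).2.2, (hg s v).2.2]
      cases s <;> simp [huv]
    -- A smaller index gives a larger root, so the smaller of the two indices is pushed out in both
    -- signs.
    rcases le_total x y with hxy | hxy
    · refine ⟨x, hx, fun s => ?_⟩
      cases s
      · exact hgx
      · exact fun h3 => hgy (anti _ _ _ hxy h3)
    · refine ⟨y, hy, fun s => ?_⟩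
      cases s
      · exact fun h3 => hgx (anti _ _ _ hxy h3)
      · exact hgy
  · rintro ⟨x, hx, hgx⟩ s
    exact (e2 s).2 ⟨x, hx, hgx s⟩

/-- The two branches rejoin here: both roots `e_i ± e_{n-1}` are pushed to `e_i + e_{n-2}`, so the
two signs can be tested at one common index, the larger of the two. -/
theorem meetsRow_row_iff_meetsBoth {a : ℕ} (ha : a + 3 = n) (A : Antichains (PosRootD n))
    (h0 : root a (a + 1) false (by omega) (by omega) ∈ lowerClosure (A.1 : Set (PosRootD n)))
    (h : ∀ s, root (a + 1) (a + 2) s (by omega) (by omega) ∈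
      lowerClosure (A.1 : Set (PosRootD n))) :
    MeetsRow a (partialRow _ 0 A) ↔ MeetsBoth A := by
  let I := lowerClosure (A.1 : Set (PosRootD n))
  let f : Bool → Fin (a + 2) → PosRootD n := fun s i => root i (a + 2) s (by omega) (by omega)
  -- The minimum handles `i = a + 1 = n - 2`, where `e_i + e_{n-2}` is not a root; `e_{n-3} +
  -- e_{n-2}` takes its place.
  let g : Fin (a + 2) → PosRootD n := fun i => root (min i a) (a + 1) true (by omega) (by omega)
  have hf : ∀ s i, (f s i).i.1 = i.1 ∧ (f s i).j.1 = a + 2 ∧ (f s i).plus = s :=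
    fun s i => ⟨rfl, rfl, rfl⟩
  have hg : ∀ i, (g i).i.1 = min i.1 a ∧ (g i).j.1 = a + 1 ∧ (g i).plus = true :=
    fun i => ⟨rfl, rfl, rfl⟩
  have hf_le : ∀ s (i k : Fin (a + 2)), k.1 ≤ i.1 → f s i ≤ f s k := by
    intro s i k hik
    rw [le_iff, (hf s i).1, (hf s i).2.1, (hf s i).2.2, (hf s k).1, (hf s k).2.1, (hf s k).2.2]
    cases s <;> simp [hik]
  have e1 : ∀ s, MeetsLast s A ↔ ∃ i, f s i ∈ I ∧ g i ∉ I := by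
    intro s
    rw [← exists_mem_iff_exists_push (f s) g A]
    · constructor
      · rintro ⟨x, hx, h1, h2⟩
        have := x.i_lt_j
        have : f s ⟨x.i.1, by omega⟩ = x := by
          rw [eq_iff]; exact ⟨rfl, by rw [(hf _ _).2.1]; omega, h1.symm⟩
        exact ⟨_, this ▸ hx⟩
      · rintro ⟨x, hx⟩
        exact ⟨_, hx, rfl, ha⟩
    · intro i
      have h1 := hf s i
      have h2 := hg i
      rw [lt_iff]
      clear h0 h hf hg hf_le
      cases s <;> grind
    · intro i k hik
      have h1 := hf s i
      have h2 := hg i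
      have h3 := hf s k
      have h4 := hg k
      rw [lt_iff] at hik
      rw [le_iff]
      clear h0 h hf hg hf_le
      grind
    · intro i z hz
      have h1 := hf s i
      have h2 := hg i
      have h3 := z.i_lt_j
      have h4 := z.j.2
      rw [lt_iff] at hz
      by_cases h5 : z.j.1 = a + 2
      · right
        have hzi : z.i.1 < a + 2 := by omega
        have h6 := hf s ⟨z.i.1, hzi⟩
        refine ⟨⟨z.i.1, hzi⟩, ?_⟩
        rw [lt_iff, le_iff]
        clear h0 h hf hg hf_le
        grind
      · left
        rw [le_iff]
        clear h0 h hf hg hf_le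
        grind
  have e2 : MeetsBoth A ↔ ∃ i, (∀ s, f s i ∈ I) ∧ g i ∉ I := by
    constructor
    · intro hb
      obtain ⟨x, hx, hgx⟩ := (e1 false).1 (hb false)
      obtain ⟨y, hy, hgy⟩ := (e1 true).1 (hb true)
      rcases le_total x y with hxy | hxy
      · refine ⟨y, fun s => ?_, hgy⟩
        cases s
        · exact I.lower (hf_le false y x hxy) hx
        · exact hy
      · refine ⟨x, fun s => ?_, hgx⟩
        cases s
        · exact hx
        · exact I.lower (hf_le true x y hxy) hy
    · rintro ⟨x, hx, hgx⟩ s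
      exact (e1 s).2 ⟨x, hx s, hgx⟩
  rw [e2]
  constructor
  · rintro ⟨x, hx, h1⟩
    obtain ⟨hxI, hxlow⟩ := mem_row.1 hx
    have hxlt := x.i_lt_j
    have hxn := x.j.2
    have hne : ¬ (x.i.1 = a ∧ x.j.1 = a + 1 ∧ x.plus = false) := fun h2 =>
      hxI ((eq_iff x (root a (a + 1) false (by omega) (by omega))).2 h2 ▸ h0)
    by_cases h2 : x.j.1 = a + 1
    · have hp : x.plus = true := by
        cases hp : x.plus
        · grind
        · rfl
      have hxi : x.i.1 < a + 2 := by omega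
      have hgx : g ⟨x.i.1, hxi⟩ = x := by
        rw [eq_iff]
        exact ⟨by rw [(hg _).1]; simp only; omega, by rw [(hg _).2.1]; omega, hp.symm⟩
      refine ⟨⟨x.i.1, hxi⟩, fun s => hxlow _ ?_, by rw [hgx]; exact hxI⟩
      have h3 := hf s ⟨x.i.1, hxi⟩
      rw [lt_iff]
      clear h0 h hf hg hf_le e1 e2
      cases s <;> grind
    -- Now `x` is `e_a ± e_{n-1}`, which lies below `e_a + e_{a+1} = g (a + 1)`.
    · refine ⟨⟨a + 1, by omega⟩, fun s => h s, fun h3 => hxI (I.lower ?_ h3)⟩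
      have h4 := hg ⟨a + 1, by omega⟩
      rw [le_iff]
      clear h0 h hf hg hf_le e1 e2
      cases hp : x.plus <;> grind
  · rintro ⟨i, hfi, hgi⟩
    by_cases hall : ∀ s, f s ⟨a, by omega⟩ ∈ I
    · have hne : ({k : Fin (a + 2) | k.1 ≤ a ∧ (∀ s, f s k ∈ I) ∧ g k ∉ I}).Nonempty := by
        refine ⟨⟨min i.1 a, by omega⟩, Nat.min_le_right _ _, fun s => ?_, ?_⟩
        · rcases le_total i.1 a with hia | hia
          · have : (⟨min i.1 a, by omega⟩ : Fin (a + 2)) = i := Fin.ext (by simp [hia])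
            rw [this]; exact hfi s
          · have : (⟨min i.1 a, by omega⟩ : Fin (a + 2)) = ⟨a, by omega⟩ :=
              Fin.ext (by simp [hia])
            rw [this]; exact hall s
        · have : g ⟨min i.1 a, by omega⟩ = g i := by
            rw [eq_iff, (hg _).1, (hg i).1]
            exact ⟨by simp, rfl, rfl⟩
          rw [this]; exact hgi
      -- For the largest such `k`, the roots strictly below `g k` lie below some `f s k`, or are `g`
      -- at a larger index at most `a`; all are in `I`.
      obtain ⟨k, ⟨hka, hkf, hkg⟩, hkmax⟩ := (Set.toFinite _).exists_maximal hne
      have hgk := hg k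
      refine ⟨g k, mem_row.2 ⟨hkg, fun z hz => ?_⟩, Or.inr hgk.2.symm⟩
      have hzlt := z.i_lt_j
      have hzn := z.j.2
      rw [lt_iff] at hz
      by_cases hz1 : z ≤ f false k
      · exact I.lower hz1 (hkf false)
      by_cases hz2 : z ≤ f true k
      · exact I.lower hz2 (hkf true)
      have h1 := hf false k
      have h2 := hf true k
      rw [le_iff] at hz1 hz2
      have hz3 : z.plus = true ∧ z.j.1 = a + 1 ∧ k.1 < z.i.1 ∧ z.i.1 ≤ a := by
        clear h0 h hf hg hf_le e1 e2 hkmax hkf hall hfi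
        grind
      have hgz : g ⟨z.i.1, by omega⟩ = z := by
        rw [eq_iff, (hg _).1, (hg _).2.1, (hg _).2.2]
        exact ⟨by simp only; omega, by omega, hz3.1.symm⟩
      rw [← hgz]
      by_contra hcon
      have := hkmax (y := ⟨z.i.1, by omega⟩) ⟨hz3.2.2.2, fun s =>
        I.lower (hf_le s _ k (by simp only; omega)) (hkf s), hcon⟩
        (Fin.le_def.2 (by simp only; omega))
      rw [Fin.le_def] at this
      simp only at this
      omega
    · obtain ⟨s, hs⟩ := not_forall.1 hall
      have h1 := hf s ⟨a, by omega⟩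
      -- The missing root `e_a ± e_{n-1}` is itself in `Row A`: what lies strictly below it is below
      -- `α_a` or below the fork root of sign `s`.
      refine ⟨f s ⟨a, by omega⟩, mem_row.2 ⟨hs, fun z hz => ?_⟩, Or.inl rfl⟩
      by_cases hz1 : z ≤ root a (a + 1) false (by omega) (by omega)
      · exact I.lower hz1 h0
      by_cases hz2 : z ≤ root (a + 1) (a + 2) s (by omega) (by omega)
      · exact I.lower hz2 (h s)
      exfalso
      have hzlt := z.i_lt_j
      have hzn := z.j.2
      rw [lt_iff] at hz
      rw [le_iff, root_i, root_j, root_plus] at hz1 hz2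
      clear h0 h hf hg hf_le e1 e2 hfi hall
      grind

end PosRootD

/-! ### The fork under rowvacuation, and the diagram automorphism -/

namespace PosRootD

variable {n : ℕ}

/-- The antichain contains one of the two simple roots `e_{n-2} ± e_{n-1}` (indices start at zero)
and the other one is not below any of its elements. -/
def IsolatedLast (A : Antichains (PosRootD n)) : Prop :=
  ∃ s, (∃ x ∈ A.1, x.plus = s ∧ x.i.1 + 2 = n) ∧ ∀ x ∈ A.1, x.j.1 + 1 = n → x.plus = s

theorem mem_iff_notMem_lowerClosure_rowvacuation {x : PosRootD n} (hx : grade ℕ x = 0)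
    (A : Antichains (PosRootD n)) :
    x ∈ A.1 ↔ x ∉ lowerClosure ((rowvacuation _ A).1 : Set (PosRootD n)) := by
  rw [← mem_rowvacuation_iff_of_grade_eq_zero hx, rowvacuation_rowvacuation]

theorem grade_root_fork {a : ℕ} (ha : a + 2 = n) (s : Bool) :
    grade ℕ (root a (a + 1) s (Nat.lt_succ_self a) (by omega) : PosRootD n) = 0 := by
  cases s
  · exact grade_root_succ _
  · exact grade_root_last ha

theorem root_fork_mem_iff {a : ℕ} (ha : a + 2 = n) (s : Bool) (A : Antichains (PosRootD n)) :
    root a (a + 1) s (Nat.lt_succ_self a) (by omega) ∈ A.1 ↔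
      ∃ x ∈ A.1, x.plus = s ∧ x.i.1 + 2 = n := by
  constructor
  · exact fun h => ⟨_, h, rfl, ha⟩
  · rintro ⟨x, hx, h1, h2⟩
    have := x.i_lt_j
    have := x.j.2
    have : root a (a + 1) s (Nat.lt_succ_self a) (by omega) = x := by
      rw [eq_iff, root_i, root_j, root_plus]
      exact ⟨by omega, by omega, h1.symm⟩
    rwa [this]

theorem isolatedLast_iff {a : ℕ} (ha : a + 2 = n) (A : Antichains (PosRootD n)) :
    IsolatedLast A ↔ ∃ s, root a (a + 1) s (Nat.lt_succ_self a) (by omega) ∈ A.1 ∧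
      root a (a + 1) (!s) (Nat.lt_succ_self a) (by omega) ∉
        lowerClosure (A.1 : Set (PosRootD n)) := by
  refine exists_congr fun s => ?_
  rw [← root_fork_mem_iff ha]
  refine and_congr_right fun h => ?_
  constructor
  · intro h1 h2
    obtain ⟨x, hx, hle⟩ := mem_lowerClosure.1 h2
    have h3 := h1 x hx
    have h4 : ¬ root a (a + 1) s (Nat.lt_succ_self a) (by omega) ≤ x := fun h4 => by
      have := A.2.eq h hx h4
      rw [← this, root_le_iff, root_plus, root_j] at hle
      cases s <;> simp at hle
      omega
    have h5 := x.i_lt_j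
    have h6 := x.j.2
    rw [root_le_iff] at hle h4
    clear h h1 h2 hx
    cases s <;> grind
  · intro h1 x hx hj
    by_contra hne
    refine h1 (mem_lowerClosure.2 ⟨x, hx, ?_⟩)
    have := x.i_lt_j
    rw [root_le_iff]
    clear h h1 hx
    cases s <;> grind

/-- The condition says that one fork root is in `A` and the other is outside `I(A)`. The rule for
minimal elements interchanges these two statements between `A` and `R(A)`, with the sign reversed.
-/
theorem isolatedLast_rowvacuation (hn : 2 ≤ n) (A : Antichains (PosRootD n)) :
    IsolatedLast (rowvacuation _ A) ↔ IsolatedLast A := by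
  obtain ⟨a, rfl⟩ := Nat.exists_eq_add_of_le' hn
  rw [isolatedLast_iff rfl, isolatedLast_iff rfl, Bool.exists_bool, Bool.exists_bool]
  simp only [mem_rowvacuation_iff_of_grade_eq_zero (grade_root_fork rfl _),
    mem_iff_notMem_lowerClosure_rowvacuation (grade_root_fork rfl _) A, Bool.not_false,
    Bool.not_true]
  tauto

theorem IsolatedLast.not_meetsBoth {A : Antichains (PosRootD n)} (h : IsolatedLast A) :
    ¬ MeetsBoth A := by
  intro hb
  obtain ⟨s, -, h2⟩ := h
  obtain ⟨x, hx, h3, h4⟩ := hb (!s)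
  have := h2 x hx h4
  rw [h3] at this
  cases s <;> simp at this

theorem not_meetsLast_of_notMem {a : ℕ} (ha : a + 2 = n) {A : Antichains (PosRootD n)} {s : Bool}
    (h : root a (a + 1) s (Nat.lt_succ_self a) (by omega) ∉ lowerClosure (A.1 : Set (PosRootD n))) :
    ¬ MeetsLast s A := by
  rintro ⟨x, hx, h1, h2⟩
  refine h (mem_lowerClosure.2 ⟨x, hx, ?_⟩)
  have := x.i_lt_j
  rw [root_le_iff]
  cases s <;> grind

theorem meetsBoth_rowvacuation (hn : 2 ≤ n) (A : Antichains (PosRootD n)) (hl : ¬ IsolatedLast A) :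
    MeetsBoth (rowvacuation _ A) ↔ ¬ MeetsBoth A := by
  obtain ⟨a, rfl⟩ := Nat.exists_eq_add_of_le' hn
  have hR := fun s => mem_rowvacuation_iff_of_grade_eq_zero (grade_root_fork (a := a) rfl s) A
  have hA := fun s => mem_iff_notMem_lowerClosure_rowvacuation (grade_root_fork (a := a) rfl s) A
  by_cases hall : ∀ s, root a (a + 1) s (Nat.lt_succ_self a) (by omega) ∈
      lowerClosure (A.1 : Set (PosRootD (a + 2)))
  · have hnR : ∀ x ∈ (rowvacuation _ A).1, x.i.1 ≠ a := by
      intro x hx hi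
      have h1 := x.i_lt_j
      have h2 := x.j.2
      have : x = root a (a + 1) x.plus (Nat.lt_succ_self a) (by omega) := by
        rw [eq_iff, root_i, root_j, root_plus]
        exact ⟨hi, by omega, rfl⟩
      exact (hR x.plus).1 (this ▸ hx) (hall _)
    cases a with
    | zero =>
      refine iff_of_false ?_ (not_not.2 fun s => ?_)
      · intro hb
        obtain ⟨x, hx, -, h2⟩ := hb true
        have h1 := x.i_lt_j
        exact hnR x hx (by omega)
      · obtain ⟨x, hx, hle⟩ := mem_lowerClosure.1 (hall s)
        refine ⟨x, hx, ?_⟩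
        have h1 := x.i_lt_j
        have h2 := x.j.2
        rw [root_le_iff] at hle
        cases s <;> grind
    | succ b =>
      have hRb := mem_rowvacuation_iff_of_grade_eq_zero
        (grade_root_succ (n := b + 1 + 2) (a := b) (by omega)) A
      by_cases hb : root b (b + 1) false (by omega) (by omega) ∈
          lowerClosure (A.1 : Set (PosRootD (b + 1 + 2)))
      -- The relation passes from `A` to row `n - 3` of `Row A`, then to column `n - 3` of `R(Row
      -- A)`, then to the last column of `Row(R(Row A)) = R(A)`.
      · rw [← meetsRow_row_iff_meetsBoth rfl A hb hall,
          meetsRow_iff_not_meetsColumn_rowvacuation (by omega), not_not,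
          ← meetsBoth_row rfl _ fun s => ?_, row_rowvacuation_row]
        refine mem_lowerClosure_of_notMem_row (grade_root_fork rfl s) ?_
        rw [row_rowvacuation_row A]
        exact fun h1 => (hR s).1 h1 (hall s)
      -- Since `α_b ∉ I(A)`, the elements of `A` above the fork roots are the fork roots themselves.
      -- Also `α_b ∈ R(A)`, and it lies below every `e_i + e_{n-1}` with `i ≤ b`.
      · refine iff_of_false ?_ (not_not.2 fun s => ?_)
        · intro hb'
          obtain ⟨x, hx, hp, h2⟩ := hb' true
          have h1 := x.i_lt_j
          have h3 := hnR x hx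
          have := eq_of_le_of_mem (hRb.2 hb) hx (by
            rw [root_le_iff]
            exact ⟨by omega, Or.inr (Or.inl ⟨rfl, hp, by omega⟩)⟩)
          rw [root_j] at this
          omega
        · obtain ⟨x, hx, hle⟩ := mem_lowerClosure.1 (hall s)
          refine ⟨x, hx, ?_⟩
          have hle' : ¬ root b (b + 1) false (by omega) (by omega) ≤ x := fun hle' =>
            hb (mem_lowerClosure.2 ⟨x, hx, hle'⟩)
          have h1 := x.i_lt_j
          have h2 := x.j.2
          rw [root_le_iff] at hle hle'
          clear hR hA hall hnR hRb hb hx hl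
          cases s <;> grind
  · obtain ⟨s, hs⟩ := not_forall.1 hall
    refine iff_of_true (fun t => ?_) fun hb => not_meetsLast_of_notMem rfl hs (hb s)
    have hRs := (hR s).2 hs
    by_cases hts : t = s
    · exact ⟨_, hRs, hts ▸ rfl, rfl⟩
    have ht : t = !s := by cases s <;> cases t <;> simp at hts ⊢
    by_cases hIt : root a (a + 1) t (Nat.lt_succ_self a) (by omega) ∈
        lowerClosure (A.1 : Set (PosRootD (a + 2)))
    -- This is where non-isolation enters: the fork root of sign `t` lies in `I(A)` but not in `A`,
    -- hence in `I(R(A))`. An element of `R(A)` above it is not above the fork root of sign `s`, so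
    -- it has sign `t` and `j = n - 1`.
    · have htA : root a (a + 1) t (Nat.lt_succ_self a) (by omega) ∉ A.1 := by
        intro h1
        refine hl ((isolatedLast_iff rfl A).2 ⟨t, h1, ?_⟩)
        rw [ht, Bool.not_not]
        exact hs
      rw [hA, not_not] at htA
      obtain ⟨x, hx, hle⟩ := mem_lowerClosure.1 htA
      refine ⟨x, hx, ?_⟩
      have h4 : ¬ root a (a + 1) s (Nat.lt_succ_self a) (by omega) ≤ x := fun h4 => by
        have := (rowvacuation _ A).2.eq hRs hx h4
        rw [← this, root_le_iff, root_plus, root_j] at hle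
        cases s <;> cases t <;> simp at hle hts
      have h1 := x.i_lt_j
      have h2 := x.j.2
      rw [root_le_iff] at hle h4
      clear hR hA hall hIt hs hRs htA hx hl
      cases s <;> cases t <;> grind
    · exact ⟨_, (hR t).2 hIt, rfl, rfl⟩

/-- The automorphism of the root poset that exchanges `e_i - e_{n-1}` and `e_i + e_{n-1}`. -/
def flip (n : ℕ) : PosRootD n ≃o PosRootD n where
  toFun x := ⟨x.i, x.j, x.lt, if x.j.1 + 1 = n then !x.plus else x.plus⟩
  invFun x := ⟨x.i, x.j, x.lt, if x.j.1 + 1 = n then !x.plus else x.plus⟩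
  left_inv x := by
    rw [eq_iff]
    refine ⟨rfl, rfl, ?_⟩
    by_cases h : x.j.1 + 1 = n <;> simp [h]
  right_inv x := by
    rw [eq_iff]
    refine ⟨rfl, rfl, ?_⟩
    by_cases h : x.j.1 + 1 = n <;> simp [h]
  map_rel_iff' {x y} := by
    have := x.j.2
    have := y.j.2
    simp only [Equiv.coe_fn_mk, le_iff]
    cases hx : x.plus <;> cases hy : y.plus <;> grind

theorem grade_flip (x : PosRootD n) : grade ℕ (flip n x) = grade ℕ x := by
  have h1 := x.i_lt_j
  have h2 := x.j.2
  rw [grade_eq_rk, grade_eq_rk]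
  simp only [rk, flip, RelIso.coe_fn_mk, Equiv.coe_fn_mk]
  rcases Bool.eq_false_or_eq_true x.plus with h | h <;> by_cases hj : x.j.1 + 1 = n <;>
    simp [h, hj] <;> omega

/-- The antichain is invariant under the automorphism `flip`. -/
def IsSymmetric (A : Antichains (PosRootD n)) : Prop := ∀ x, flip n x ∈ A.1 ↔ x ∈ A.1

theorem isSymmetric_rowvacuation (A : Antichains (PosRootD n)) :
    IsSymmetric (rowvacuation _ A) ↔ IsSymmetric A := by
  constructor
  · intro h
    have := rowvacuation_invariant (flip n) grade_flip _ h
    rwa [rowvacuation_rowvacuation] at this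
  · exact rowvacuation_invariant (flip n) grade_flip A

end PosRootD

/-! ### Counting roots by rows and columns -/

namespace PosRootD

variable {n : ℕ}

open Classical in
theorem card_filter_column (A : Antichains (PosRootD n)) (a : ℕ) :
    (A.1.filter fun x => x.plus = false ∧ x.j.1 = a + 1).card = if MeetsColumn a A then 1 else 0 := by
  split_ifs with h
  · obtain ⟨x, hx, h1⟩ := h
    refine Finset.card_eq_one.2 ⟨x, Finset.eq_singleton_iff_unique_mem.2
      ⟨Finset.mem_filter.2 ⟨hx, h1⟩, fun y hy => ?_⟩⟩
    obtain ⟨hy, h2⟩ := Finset.mem_filter.1 hy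
    rcases le_total x.i.1 y.i.1 with h3 | h3
    · exact A.2.eq hy hx ((le_iff _ _).2 ⟨h3, Or.inl ⟨h2.1, h1.1, by omega⟩⟩)
    · exact (A.2.eq hx hy ((le_iff _ _).2 ⟨h3, Or.inl ⟨h1.1, h2.1, by omega⟩⟩)).symm
  · exact Finset.card_eq_zero.2 (Finset.filter_eq_empty_iff.2 fun x hx h1 => h ⟨x, hx, h1⟩)

theorem eq_of_mem_last {A : Antichains (PosRootD n)} {x y : PosRootD n} (hx : x ∈ A.1)
    (hy : y ∈ A.1) (hxj : x.j.1 + 1 = n) (hyj : y.j.1 + 1 = n) (h : x.plus = y.plus) : x = y := by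
  rcases le_total x.i.1 y.i.1 with h3 | h3
  · refine (A.2.eq hy hx ((le_iff _ _).2 ⟨h3, ?_⟩)).symm
    cases hp : y.plus <;> simp [hp, h] <;> omega
  · refine A.2.eq hx hy ((le_iff _ _).2 ⟨h3, ?_⟩)
    cases hp : y.plus <;> simp [hp, h] <;> omega

open Classical in
theorem card_filter_last (A : Antichains (PosRootD n)) (s : Bool) :
    (A.1.filter fun x => x.plus = s ∧ x.j.1 + 1 = n).card = if MeetsLast s A then 1 else 0 := by
  split_ifs with h
  · obtain ⟨x, hx, h1⟩ := h
    refine Finset.card_eq_one.2 ⟨x, Finset.eq_singleton_iff_unique_mem.2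
      ⟨Finset.mem_filter.2 ⟨hx, h1⟩, fun y hy => ?_⟩⟩
    obtain ⟨hy, h2⟩ := Finset.mem_filter.1 hy
    exact eq_of_mem_last hy hx h2.2 h1.2 (h2.1.trans h1.1.symm)
  · exact Finset.card_eq_zero.2 (Finset.filter_eq_empty_iff.2 fun x hx h1 => h ⟨x, hx, h1⟩)

/-- The antichain contains both roots `e_a ± e_{n-1}` (indices start at zero). -/
def HasTwins (a : ℕ) (A : Antichains (PosRootD n)) : Prop :=
  ∀ s, ∃ x ∈ A.1, x.plus = s ∧ x.i.1 = a ∧ x.j.1 + 1 = n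

-- The roots of a row are pairwise comparable except for `e_a - e_{n-1}` and `e_a + e_{n-1}`.
open Classical in
theorem card_filter_row (A : Antichains (PosRootD n)) {a : ℕ} (ha : a + 2 < n) :
    (A.1.filter fun x => x.i.1 = a ∨ (x.plus = true ∧ x.j.1 = a + 1)).card =
      (if MeetsRow a A then 1 else 0) + if HasTwins a A then 1 else 0 := by
  by_cases ht : HasTwins a A
  · obtain ⟨x, hx, h1, h2, h3⟩ := ht false
    obtain ⟨y, hy, h4, h5, h6⟩ := ht true
    have hr : MeetsRow a A := ⟨x, hx, Or.inl h2⟩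
    rw [if_pos ht, if_pos hr]
    have hxy : x ≠ y := fun h => by rw [h, h4] at h1; simp at h1
    refine Finset.card_eq_two.2 ⟨x, y, hxy, Finset.ext fun z => ?_⟩
    rw [Finset.mem_filter, Finset.mem_insert, Finset.mem_singleton]
    constructor
    · rintro ⟨hz, h7⟩
      have e1 := fun h => A.2.eq hx hz h
      have e2 := fun h => A.2.eq hz hx h
      have e3 := fun h => A.2.eq hy hz h
      have e4 := fun h => A.2.eq hz hy h
      rw [le_iff] at e1 e2 e3 e4
      have := z.i_lt_j
      have := z.j.2
      clear ht hr
      cases hp : z.plus <;> grind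
    · rintro (rfl | rfl)
      · exact ⟨hx, Or.inl h2⟩
      · exact ⟨hy, Or.inl h5⟩
  · rw [if_neg ht, add_zero]
    split_ifs with h
    · obtain ⟨x, hx, h1⟩ := h
      refine Finset.card_eq_one.2 ⟨x, Finset.eq_singleton_iff_unique_mem.2
        ⟨Finset.mem_filter.2 ⟨hx, h1⟩, fun y hy => ?_⟩⟩
      obtain ⟨hy, h2⟩ := Finset.mem_filter.1 hy
      by_contra hne
      have e1 : ¬ x ≤ y := fun h => hne (A.2.eq hx hy h).symm
      have e2 : ¬ y ≤ x := fun h => hne (A.2.eq hy hx h)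
      have h3 : x.i.1 = a ∧ x.j.1 + 1 = n ∧ y.i.1 = a ∧ y.j.1 + 1 = n ∧ x.plus = !y.plus := by
        rw [le_iff] at e1 e2
        have := x.i_lt_j
        have := x.j.2
        have := y.i_lt_j
        have := y.j.2
        clear ht hne
        cases hp : x.plus <;> cases hq : y.plus <;> grind
      refine ht fun s => ?_
      by_cases hs : x.plus = s
      · exact ⟨x, hx, hs, h3.1, h3.2.1⟩
      · refine ⟨y, hy, ?_, h3.2.2.1, h3.2.2.2.1⟩
        rw [h3.2.2.2.2] at hs
        cases hq : y.plus <;> cases s <;> simp [hq] at hs ⊢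
    · exact Finset.card_eq_zero.2 (Finset.filter_eq_empty_iff.2 fun x hx h1 => h ⟨x, hx, h1⟩)

open Classical in
theorem sum_meetsColumn (A : Antichains (PosRootD n)) :
    ∑ a ∈ Finset.range (n - 2), (if MeetsColumn a A then 1 else 0) =
      (A.1.filter fun x => x.plus = false ∧ x.j.1 + 1 < n).card := by
  simp_rw [← card_filter_column, Finset.card_filter]
  rw [Finset.sum_comm]
  refine Finset.sum_congr rfl fun x _ => ?_
  have := x.i_lt_j
  have := x.j.2
  by_cases h : x.plus = false ∧ x.j.1 + 1 < n
  · rw [if_pos h, Finset.sum_eq_single (x.j.1 - 1)]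
    · rw [if_pos ⟨h.1, by omega⟩]
    · intro b _ hb
      exact if_neg fun h1 => hb (by omega)
    · intro h1
      rw [Finset.mem_range] at h1
      omega
  · rw [if_neg h]
    refine Finset.sum_eq_zero fun b hb => if_neg fun h1 => h ⟨h1.1, ?_⟩
    rw [Finset.mem_range] at hb
    omega

/-- The number of roots `e_i + e_{i+1}` and `e_{n-2} - e_{n-1}` in the antichain (indices start at
zero). -/
def selfDualCard (A : Antichains (PosRootD n)) : ℕ :=
  (A.1.filter fun x => x.j.1 = x.i.1 + 1 ∧ (x.plus = true ∨ x.j.1 + 1 = n)).card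

open Classical in
/-- The number of `a < n - 2` such that the antichain contains both roots `e_a ± e_{n-1}`. -/
noncomputable def twinCard (A : Antichains (PosRootD n)) : ℕ :=
  ∑ a ∈ Finset.range (n - 2), if HasTwins a A then 1 else 0

-- Double counting of pairs (root, row `a < n - 2` containing it). A root `e_i + e_j` with `j < n -
-- 1` lies in rows `i` and `j - 1`, every other root in row `i` only. `selfDualCard` corrects for
-- the coincidence `j - 1 = i` and for the fork roots, whose row index `n - 2` is out of range.
open Classical in
theorem sum_meetsRow (A : Antichains (PosRootD n)) :
    ∑ a ∈ Finset.range (n - 2), (if MeetsRow a A then 1 else 0) + twinCard A + selfDualCard A =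
      (A.1.filter fun x => x.plus = false ∧ x.j.1 + 1 < n).card +
        (A.1.filter fun x => x.j.1 + 1 = n).card +
        2 * (A.1.filter fun x => x.plus = true ∧ x.j.1 + 1 < n).card := by
  have h : ∑ a ∈ Finset.range (n - 2), (if MeetsRow a A then 1 else 0) + twinCard A =
      ∑ a ∈ Finset.range (n - 2),
        (A.1.filter fun x => x.i.1 = a ∨ (x.plus = true ∧ x.j.1 = a + 1)).card := by
    rw [twinCard, ← Finset.sum_add_distrib]
    refine Finset.sum_congr rfl fun a ha => (card_filter_row A ?_).symm
    rw [Finset.mem_range] at ha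
    omega
  rw [h, selfDualCard]
  simp_rw [Finset.card_filter]
  rw [Finset.sum_comm, Finset.mul_sum, ← Finset.sum_add_distrib, ← Finset.sum_add_distrib,
    ← Finset.sum_add_distrib]
  refine Finset.sum_congr rfl fun x _ => ?_
  have h1 := x.i_lt_j
  have h2 := x.j.2
  rw [← Finset.card_filter]
  have key : ∀ s : Finset ℕ, (∀ a, (a < n - 2 ∧ (x.i.1 = a ∨ (x.plus = true ∧ x.j.1 = a + 1))) ↔
      a ∈ s) → ((Finset.range (n - 2)).filter fun a =>
        x.i.1 = a ∨ (x.plus = true ∧ x.j.1 = a + 1)) = s := by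
    intro s hs
    ext a
    rw [Finset.mem_filter, Finset.mem_range, hs]
  by_cases hj : x.j.1 + 1 = n
  · by_cases hi : x.i.1 + 2 = n
    · rw [key ∅ fun a => by simp; omega]
      have : x.j.1 = x.i.1 + 1 := by omega
      simp [this, hi]
    · rw [key {x.i.1} fun a => by simp; omega]
      have : x.j.1 ≠ x.i.1 + 1 := by omega
      simp [hj, this]
  · have hj' : x.j.1 + 1 < n := by omega
    rcases Bool.eq_false_or_eq_true x.plus with hp | hp
    · by_cases hij : x.j.1 = x.i.1 + 1
      · rw [key {x.i.1} fun a => by simp [hp]; omega]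
        rw [hij] at hj hj'
        simp [hp, hij, hj, hj']
      · rw [key {x.i.1, x.j.1 - 1} fun a => by simp [hp]; omega, Finset.card_pair (by omega)]
        simp [hp, hij, hj, hj']
    · rw [key {x.i.1} fun a => by simp [hp]; omega]
      simp [hp, hj, hj']

theorem card_eq_add (A : Antichains (PosRootD n)) :
    A.1.card = (A.1.filter fun x => x.plus = false ∧ x.j.1 + 1 < n).card +
        (A.1.filter fun x => x.j.1 + 1 = n).card +
        (A.1.filter fun x => x.plus = true ∧ x.j.1 + 1 < n).card := by
  simp_rw [Finset.card_filter]
  rw [Finset.card_eq_sum_ones, ← Finset.sum_add_distrib, ← Finset.sum_add_distrib]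
  refine Finset.sum_congr rfl fun x _ => ?_
  have := x.j.2
  by_cases hj : x.j.1 + 1 = n
  · simp [hj]
  · have hj' : x.j.1 + 1 < n := by omega
    cases hp : x.plus <;> simp [hj, hj']

open Classical in
theorem sum_meetsRow_add_sum_meetsColumn (A : Antichains (PosRootD n)) :
    ∑ a ∈ Finset.range (n - 2), (if MeetsRow a A then 1 else 0) +
      ∑ a ∈ Finset.range (n - 2), (if MeetsColumn a (rowvacuation _ A) then 1 else 0) = n - 2 := by
  rw [← Finset.sum_add_distrib]
  conv_rhs => rw [← Finset.card_range (n - 2), Finset.card_eq_sum_ones]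
  refine Finset.sum_congr rfl fun a ha => ?_
  rw [Finset.mem_range] at ha
  have := meetsRow_iff_not_meetsColumn_rowvacuation (n := n) (a := a) (by omega) A
  by_cases h : MeetsColumn a (rowvacuation _ A) <;> simp [this, h]

open Classical in
theorem card_last (A : Antichains (PosRootD n)) :
    (A.1.filter fun x => x.j.1 + 1 = n).card =
      (if MeetsLast false A then 1 else 0) + if MeetsLast true A then 1 else 0 := by
  rw [← card_filter_last, ← card_filter_last]
  simp_rw [Finset.card_filter]
  rw [← Finset.sum_add_distrib]
  refine Finset.sum_congr rfl fun x _ => ?_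
  cases hp : x.plus <;> simp

theorem flip_i (x : PosRootD n) : (flip n x).i = x.i := rfl

theorem flip_j (x : PosRootD n) : (flip n x).j = x.j := rfl

theorem flip_plus_of_eq {x : PosRootD n} (h : x.j.1 + 1 = n) : (flip n x).plus = !x.plus :=
  if_pos h

theorem flip_of_ne {x : PosRootD n} (h : x.j.1 + 1 ≠ n) : flip n x = x := by
  rw [eq_iff]
  exact ⟨rfl, rfl, if_neg h⟩

/-- An antichain has at most one root `e_i ± e_{n-1}` of each sign, so the twins are all of its
roots moved by `flip`. -/
theorem isSymmetric_of_hasTwins {a : ℕ} {A : Antichains (PosRootD n)} (h : HasTwins a A) :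
    IsSymmetric A := by
  have key : ∀ x ∈ A.1, flip n x ∈ A.1 := by
    intro x hx
    by_cases hj : x.j.1 + 1 = n
    · obtain ⟨y, hy, h1, h2, h3⟩ := h x.plus
      obtain ⟨z, hz, h4, h5, h6⟩ := h (!x.plus)
      have hxy := eq_of_mem_last hx hy hj h3 h1.symm
      have : flip n x = z := by
        rw [eq_iff, flip_i, flip_j, flip_plus_of_eq hj]
        refine ⟨?_, by omega, h4.symm⟩
        rw [hxy]
        omega
      rwa [this]
    · rwa [flip_of_ne hj]
  intro x
  refine ⟨fun hx => ?_, key x⟩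
  have := key _ hx
  rwa [show flip n (flip n x) = x from (flip n).left_inv x] at this

theorem twinCard_eq_zero {A : Antichains (PosRootD n)} (h : ∀ a, a + 2 < n → ¬ HasTwins a A) :
    twinCard A = 0 := by
  classical
  refine Finset.sum_eq_zero fun a ha => if_neg (h a ?_)
  rw [Finset.mem_range] at ha
  omega

theorem twinCard_eq_one {A : Antichains (PosRootD n)} {a : ℕ} (ha : a + 2 < n) (h : HasTwins a A) :
    twinCard A = 1 := by
  classical
  rw [twinCard, Finset.sum_eq_single a, if_pos h]
  · intro b _ hb
    refine if_neg fun h' => hb ?_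
    obtain ⟨x, hx, h1, h2, h3⟩ := h true
    obtain ⟨y, hy, h4, h5, h6⟩ := h' true
    have := eq_of_mem_last hx hy h3 h6 (h1.trans h4.symm)
    rw [← h2, ← h5, this]
  · intro h1
    rw [Finset.mem_range] at h1
    omega

/-- The roots counted form a chain apart from the two fork roots at its bottom. -/
theorem selfDualCard_le_one {A : Antichains (PosRootD n)} (h : ∀ a, a + 2 = n → ¬ HasTwins a A) :
    selfDualCard A ≤ 1 := by
  refine Finset.card_le_one.2 fun x hx y hy => ?_
  obtain ⟨hx, h1, h2⟩ := Finset.mem_filter.1 hx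
  obtain ⟨hy, h3, h4⟩ := Finset.mem_filter.1 hy
  by_contra hne
  have e1 : ¬ x ≤ y := fun h => hne (A.2.eq hx hy h)
  have e2 : ¬ y ≤ x := fun h => hne (A.2.eq hy hx h).symm
  have h5 : x.j.1 + 1 = n ∧ y.j.1 + 1 = n ∧ x.plus = !y.plus := by
    rw [le_iff] at e1 e2
    have := x.j.2
    have := y.j.2
    clear h hne
    cases hp : x.plus <;> cases hq : y.plus <;> grind
  refine h x.i.1 (by omega) fun s => ?_
  by_cases hs : x.plus = s
  · exact ⟨x, hx, hs, rfl, h5.1⟩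
  · refine ⟨y, hy, ?_, by omega, h5.2.1⟩
    rw [h5.2.2] at hs
    cases hq : y.plus <;> cases s <;> simp [hq] at hs ⊢

theorem selfDualCard_eq_two {A : Antichains (PosRootD n)} {a : ℕ} (ha : a + 2 = n)
    (h : HasTwins a A) : selfDualCard A = 2 := by
  obtain ⟨x, hx, h1, h2, h3⟩ := h false
  obtain ⟨y, hy, h4, h5, h6⟩ := h true
  have hxy : x ≠ y := fun h => by rw [h, h4] at h1; simp at h1
  refine Finset.card_eq_two.2 ⟨x, y, hxy, Finset.ext fun z => ?_⟩
  rw [Finset.mem_filter, Finset.mem_insert, Finset.mem_singleton]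
  constructor
  · rintro ⟨hz, h7⟩
    have e1 := fun h => A.2.eq hx hz h
    have e3 := fun h => A.2.eq hy hz h
    rw [le_iff] at e1 e3
    have := z.i_lt_j
    have := z.j.2
    clear h
    cases hp : z.plus <;> grind
  · rintro (rfl | rfl)
    · exact ⟨hx, by omega, Or.inr h3⟩
    · exact ⟨hy, by omega, Or.inl h4⟩

theorem IsSymmetric.hasTwins {A : Antichains (PosRootD n)} (hA : IsSymmetric A) {x : PosRootD n}
    (hx : x ∈ A.1) (hj : x.j.1 + 1 = n) : HasTwins x.i.1 A := by
  intro s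
  by_cases hs : x.plus = s
  · exact ⟨x, hx, hs, rfl, hj⟩
  · refine ⟨flip n x, (hA x).2 hx, ?_, rfl, hj⟩
    rw [flip_plus_of_eq hj]
    cases hq : x.plus <;> cases s <;> simp [hq] at hs ⊢

theorem IsSymmetric.meetsBoth_of_meetsLast {A : Antichains (PosRootD n)} (hA : IsSymmetric A)
    {s : Bool} (h : MeetsLast s A) : MeetsBoth A := by
  obtain ⟨x, hx, -, hj⟩ := h
  intro t
  obtain ⟨y, hy, h1, -, h2⟩ := hA.hasTwins hx hj t
  exact ⟨y, hy, h1, h2⟩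

theorem MeetsBoth.card_last {A : Antichains (PosRootD n)} (h : MeetsBoth A) :
    (A.1.filter fun x => x.j.1 + 1 = n).card = 2 := by
  classical
  rw [PosRootD.card_last, if_pos (h false), if_pos (h true)]

theorem IsSymmetric.card_last {A : Antichains (PosRootD n)} (hA : IsSymmetric A)
    (h : ¬ MeetsBoth A) : (A.1.filter fun x => x.j.1 + 1 = n).card = 0 := by
  classical
  rw [PosRootD.card_last, if_neg fun h1 => h (hA.meetsBoth_of_meetsLast h1),
    if_neg fun h1 => h (hA.meetsBoth_of_meetsLast h1)]

theorem card_last_of_not_isSymmetric {A : Antichains (PosRootD n)} (hA : ¬ IsSymmetric A)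
    (h : ¬ MeetsBoth A) : (A.1.filter fun x => x.j.1 + 1 = n).card = 1 := by
  classical
  have h1 : MeetsLast false A ∨ MeetsLast true A := by
    by_contra! hcon
    refine hA fun x => ?_
    by_cases hj : x.j.1 + 1 = n
    · refine iff_of_false (fun hx => ?_) fun hx => ?_
      · cases hp : (flip n x).plus
        · exact hcon.1 ⟨_, hx, hp, hj⟩
        · exact hcon.2 ⟨_, hx, hp, hj⟩
      · cases hp : x.plus
        · exact hcon.1 ⟨_, hx, hp, hj⟩
        · exact hcon.2 ⟨_, hx, hp, hj⟩
    · rw [flip_of_ne hj]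
  rw [MeetsBoth, Bool.forall_bool] at h
  rw [PosRootD.card_last]
  split_ifs <;> tauto

/-- By symmetry the two roots with `j = n - 1` are twins. Fork twins count 2 in `selfDualCard` and 0
in `twinCard`; any other twins count 1 in `twinCard` and leave `selfDualCard` at most 1. -/
theorem MeetsBoth.twinCard_add_selfDualCard_bounds {A : Antichains (PosRootD n)} (hA : IsSymmetric A)
    (h : MeetsBoth A) : 1 ≤ twinCard A + selfDualCard A ∧ twinCard A + selfDualCard A ≤ 2 := by
  obtain ⟨x, hx, -, hj⟩ := h true
  have ht := hA.hasTwins hx hj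
  have hlt := x.i_lt_j
  have huniq : ∀ a, HasTwins a A → a = x.i.1 := by
    intro a ha
    obtain ⟨y, hy, h1, h2, h3⟩ := ha x.plus
    rw [← h2, eq_of_mem_last hx hy hj h3 h1.symm]
  by_cases hi : x.i.1 + 2 = n
  · rw [selfDualCard_eq_two hi ht, twinCard_eq_zero fun a ha h1 => by
      have := huniq a h1
      omega]
    omega
  · have := selfDualCard_le_one (A := A) fun a ha h1 => hi (huniq a h1 ▸ ha)
    rw [twinCard_eq_one (by omega) ht]
    omega

theorem twinCard_add_selfDualCard_le_one {A : Antichains (PosRootD n)} (h : ¬ MeetsBoth A) :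
    twinCard A + selfDualCard A ≤ 1 := by
  have hno : ∀ a, ¬ HasTwins a A := fun a ha => h fun s => by
    obtain ⟨x, hx, h1, -, h2⟩ := ha s
    exact ⟨x, hx, h1, h2⟩
  rw [twinCard_eq_zero fun a _ => hno a, zero_add]
  exact selfDualCard_le_one fun a _ => hno a

theorem twinCard_add_selfDualCard_le_one_of_not_isSymmetric {A : Antichains (PosRootD n)} (hA : ¬ IsSymmetric A) :
    twinCard A + selfDualCard A ≤ 1 := by
  have hno : ∀ a, ¬ HasTwins a A := fun a ha => hA (isSymmetric_of_hasTwins ha)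
  rw [twinCard_eq_zero fun a _ => hno a, zero_add]
  exact selfDualCard_le_one fun a _ => hno a

theorem IsolatedLast.not_isSymmetric {A : Antichains (PosRootD n)} (h : IsolatedLast A) :
    ¬ IsSymmetric A := by
  intro hA
  obtain ⟨s, ⟨x, hx, hp, hi⟩, h2⟩ := id h
  have := x.i_lt_j
  have := x.j.2
  exact h.not_meetsBoth (hA.meetsBoth_of_meetsLast ⟨x, hx, hp, by omega⟩)

theorem IsolatedLast.one_le_selfDualCard {A : Antichains (PosRootD n)} (h : IsolatedLast A) :
    1 ≤ selfDualCard A := by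
  obtain ⟨s, ⟨x, hx, hp, hi⟩, h2⟩ := h
  have := x.i_lt_j
  have := x.j.2
  exact Finset.card_pos.2 ⟨x, Finset.mem_filter.2 ⟨hx, by omega, Or.inr (by omega)⟩⟩

/-- The counting identities reduce the claim to `ℓ(A) + ℓ(R(A)) + δ(A) + δ(R(A)) = 4`, a sum already
known to be even; `omega` supplies the parity step. -/
theorem card_add_card_rowvacuation (hn : 2 ≤ n) (A : Antichains (PosRootD n)) :
    A.1.card + (rowvacuation (PosRootD n) A).1.card = n := by
  classical
  have hs1 := sum_meetsRow_add_sum_meetsColumn A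
  have hs2 := sum_meetsRow_add_sum_meetsColumn (rowvacuation _ A)
  rw [rowvacuation_rowvacuation] at hs2
  have hr1 := sum_meetsRow A
  have hr2 := sum_meetsRow (rowvacuation _ A)
  rw [sum_meetsColumn] at hs1 hs2
  have hc1 := card_eq_add A
  have hc2 := card_eq_add (rowvacuation _ A)
  have hsym := isSymmetric_rowvacuation A
  have hiso := isolatedLast_rowvacuation hn A
  -- In the isolated case every one of the four terms equals 1.
  by_cases hl : IsolatedLast A
  · have h1 := card_last_of_not_isSymmetric hl.not_isSymmetric hl.not_meetsBoth
    have h2 := card_last_of_not_isSymmetric (hiso.2 hl).not_isSymmetric (hiso.2 hl).not_meetsBoth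
    have h3 := hl.one_le_selfDualCard
    have h4 := (hiso.2 hl).one_le_selfDualCard
    have h5 :=
      twinCard_add_selfDualCard_le_one_of_not_isSymmetric hl.not_isSymmetric
    have h6 :=
      twinCard_add_selfDualCard_le_one_of_not_isSymmetric (hiso.2 hl).not_isSymmetric
    omega
  have hb := meetsBoth_rowvacuation hn A hl
  -- Symmetric case: the values of `ℓ` are 2 and 0, and the values of `δ` add up to between 1 and 3.
  -- Otherwise the values of `ℓ` are 2 and 1, and those of `δ` add up to at most 2.
  by_cases hA : IsSymmetric A
  · have hR := hsym.2 hA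
    by_cases hbA : MeetsBoth A
    · have hbR : ¬ MeetsBoth (rowvacuation _ A) := fun h => hb.1 h hbA
      have h1 := hbA.card_last
      have h2 := hR.card_last hbR
      have h3 := hbA.twinCard_add_selfDualCard_bounds hA
      have h4 := twinCard_add_selfDualCard_le_one hbR
      omega
    · have hbR := hb.2 hbA
      have h1 := hA.card_last hbA
      have h2 := hbR.card_last
      have h3 := hbR.twinCard_add_selfDualCard_bounds hR
      have h4 := twinCard_add_selfDualCard_le_one hbA
      omega
  · have hR : ¬ IsSymmetric (rowvacuation _ A) := fun h => hA (hsym.1 h)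
    have h5 :=
      twinCard_add_selfDualCard_le_one_of_not_isSymmetric hA
    have h6 :=
      twinCard_add_selfDualCard_le_one_of_not_isSymmetric hR
    by_cases hbA : MeetsBoth A
    · have h1 := hbA.card_last
      have h2 := card_last_of_not_isSymmetric hR fun h => hb.1 h hbA
      omega
    · have h1 := card_last_of_not_isSymmetric hA hbA
      have h2 := (hb.2 hbA).card_last
      omega

end PosRootD

theorem mainTheorem2 (n : ℕ) (hn : 2 ≤ n) (A : Antichains (PosRootD n)) :
    A.1.card + (rowvacuation (PosRootD n) A).1.card = n :=
  PosRootD.card_add_card_rowvacuation hn A
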